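/- **Setting.** Let $\mathfrak g$ be the complexification of the Lie algebra $\mathfrak g_0$ of a compact, simple, simply connected Lie group; that is, $\mathfrak g$ is a finite-dimensional simple complex Lie algebra with a conjugate-linear involution $x\mapsto x^*$ satisfying $[x,y]^*=[y^*,x^*]$ such that the Killing form is negative definite on $\mathfrak g_0=\{x\in\mathfrak g: x^*=-x\}$. Let $\langle\cdot,\cdot\rangle$ be the basic inner product, i.e. the multiple of the Killing form for which the highest root $\theta$ has $\langle\theta,\theta\rangle=2$. Fix a norm on $\mathfrak g$ with $\|x^*\|=\|x\|$. Let $L\mathfrak g=C^\infty(S^1,\mathfrak g)$, with pointwise bracket and pointwise involution $X^*(\theta)=X(\theta)^*$, and $\dot X=dX/d\theta$. For $s\ge 0$ let $H^s(S^1,\mathfrak g)$ be the space of $X=\sum_k a_ke^{ik\theta}\in L^2(S^1,\mathfrak g)$ with $\|X\|_{H^s}^2=\sum_k(1+|k|)^{2s}\|a_k\|^2<\infty$, and $H^s(S^1,\mathfrak g_0)$ the subspace of those $X$ with $X(\theta)\in\mathfrak g_0$ for almost every $\theta$. Let $\mathcal H=\bigoplus_{n\ge0}\mathcal H(n)$ be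 a Hilbert space decomposed into finite-dimensional, mutually orthogonal subspaces with $\mathcal H(0)\neq0$. Let $d$ be the self-adjoint operator equal to $n$ on $\mathcal H(n)$, let $\mathcal H^s$ be the domain of $(1+d)^s$ with norm $\|\xi\|_s=\|(1+d)^s\xi\|$, and let $\mathcal H^\infty=\bigcap_k\mathcal H^k$. Let $\pi$ be a positive energy representation of $L\mathfrak g$ on $\mathcal H$ of level $\ell$, i.e. a linear map $X\mapsto\pi(X)$ from $L\mathfrak g$ to the linear operators $\mathcal H^\infty\to\mathcal H^\infty$ such that, on $\mathcal H^\infty$, $$[\pi(X),\pi(Y)]=\pi([X,Y])+i\ell B(X,Y),\qquad B(X,Y)=\int_0^{2\pi}\langle X,\dot Y\rangle\,\frac{d\theta}{2\pi},$$ $$[d,\pi(X)]=i\pi(\dot X),\qquad (\xi\,|\,\pi(X)\eta)=(\pi(X^*)\xi\,|\,\eta).$$ **Proposition.** The representation $\pi$ extends to $H^{3/2}(S^1,\mathfrak g)$: there is a linear map $X\mapsto\pi(X)$ from $H^{3/2}(S^1,\mathfrak g)$ to the linear operators $\mathcal H^{1/2}\to\mathcal H$, which on $L\mathfrak g\subset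 H^{3/2}(S^1,\mathfrak g)$ and $\mathcal H^\infty\subset\mathcal H^{1/2}$ agrees with the given $\pi$, which satisfies the commutation relations in the weak form $$(\pi(X^*)\xi\,|\,\pi(Y)\eta)-(\pi(Y^*)\xi\,|\,\pi(X)\eta)=(\xi\,|\,\pi([X,Y])\eta)+i\ell B(X,Y)(\xi\,|\,\eta),\qquad \xi,\eta\in\mathcal H^{1/2},$$ for $X,Y\in H^{3/2}(S^1,\mathfrak g)$ with $[X,Y] \in H^{3/2}(S^1,\mathfrak g)$ (where $\dot Y$ in $B(X,Y)$ is the weak derivative), and for which there is a constant $C$ with $$\|\pi(X)\xi\|\le C\,\|X\|_{H^{3/2}}\,\|\xi\|_{1/2},\qquad X\in H^{3/2}(S^1,\mathfrak g),\ \xi\in\mathcal H^{1/2}.$$ For every $X\in H^{3/2}(S^1,\mathfrak g)$ the operator $\pi(X)$, with dense domain $\mathcal H^{1/2}$, is closable, and $\pi(X)^*=\overline{\pi(X^*)}$. In particular, if $X\in H^{3/2}(S^1,\mathfrak g_0)$ then $\pi(X)$ is essentially skew-adjoint, i.e. its closure is skew-adjoint. -/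

import Mathlib

open scoped ContDiff InnerProductSpace
open MeasureTheory

/-! ## Normed Lie algebras and the basic inner product -/

/-- A normed abelian group with a Lie bracket (no compatibility of norm and bracket is needed,
since only finite-dimensional examples are used). -/
class NormedLieRing (𝔤 : Type*) extends NormedAddCommGroup 𝔤, LieRing 𝔤

/-- A complex Lie algebra with a norm. -/
class NormedLieAlgebra (𝔤 : Type*) [NormedLieRing 𝔤] extends NormedSpace ℂ 𝔤, LieAlgebra ℂ 𝔤

/-- The conjugate-linear involution `star` of the complex Lie algebra `𝔤` is the one of a compact
real form `𝔤₀ = {x | star x = -x}`: it reverses brackets, and the Killing form is negative definite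
on `𝔤₀`. (That `star` is conjugate-linear and involutive is `StarAddMonoid`, `StarModule ℂ`.) -/
class IsCompactInvolution (𝔤 : Type*) [NormedLieRing 𝔤] [NormedLieAlgebra 𝔤]
    [StarAddMonoid 𝔤] : Prop where
  star_lie : ∀ x y : 𝔤, star ⁅x, y⁆ = ⁅star y, star x⁆
  neg_def : ∀ x : 𝔤, star x = -x → x ≠ 0 → (killingForm ℂ 𝔤 x x).re < 0

namespace LoopAlgebra

section BasicForm

variable {𝔤 : Type*} [NormedLieRing 𝔤] [NormedLieAlgebra 𝔤] [FiniteDimensional ℂ 𝔤]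
  [LieAlgebra.IsSimple ℂ 𝔤]

/-- The squared length of the highest root (equivalently, the largest squared length of a root)
with respect to the form that the Killing form induces on the dual of the Cartan
subalgebra `𝔥`. A root `α` has squared length `α t_α`, where `κ (t_α, ·) = α`; this is a positive
real number. -/
noncomputable def highestRootSq (𝔥 : LieSubalgebra ℂ 𝔤) [𝔥.IsCartanSubalgebra] : ℝ :=
  ⨆ α : 𝔥.root,
    (α.1 ((LieAlgebra.IsKilling.cartanEquivDual 𝔥).symm (LieModule.Weight.toLinear ℂ 𝔥 𝔤 α.1))).re

/-- The basic inner product: the multiple of the Killing form for which the highest root `θ`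
satisfies `⟨θ, θ⟩ = 2`. (Multiplying a form by `s` divides the dual form by `s`.) -/
noncomputable def basicForm (𝔥 : LieSubalgebra ℂ 𝔤) [𝔥.IsCartanSubalgebra] :
    LinearMap.BilinForm ℂ 𝔤 :=
  ((highestRootSq 𝔥 / 2 : ℝ) : ℂ) • killingForm ℂ 𝔤

end BasicForm

/-! ## Smooth loops and Sobolev loops -/

/-- The circle `ℝ / 2πℤ`; its normalised Haar measure is `dθ / 2π`. -/
abbrev Circ : Type := AddCircle (2 * Real.pi)

instance instFactTwoPi : Fact (0 < 2 * Real.pi) := ⟨Real.two_pi_pos⟩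

section Loops

variable (𝔤 : Type*) [NormedLieRing 𝔤] [NormedLieAlgebra 𝔤]

/-- `L𝔤 = C^∞(S¹, 𝔤)`. -/
def smoothLoops : Submodule ℂ (Circ → 𝔤) where
  carrier := {X | ContDiff ℝ ∞ fun t : ℝ => X (t : Circ)}
  zero_mem' := Set.mem_ofPred_eq.mpr contDiff_const
  add_mem' hX hY := by
    simp only [Set.mem_ofPred_eq] at *
    exact ContDiff.add hX hY
  smul_mem' c _ hX := by
    simp only [Set.mem_ofPred_eq] at *
    exact ContDiff.const_smul c hX

variable {𝔤} in
/-- Membership in `L𝔤`. -/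
theorem smoothLoops.contDiff (X : smoothLoops 𝔤) : ContDiff ℝ ∞ fun t : ℝ => X.1 (t : Circ) :=
  X.2

variable {𝔤}

/-- The derivative `Ẋ = dX/dθ` of a smooth loop. -/
noncomputable def smoothLoops.dot (X : smoothLoops 𝔤) : smoothLoops 𝔤 :=
  have hper : Function.Periodic (deriv fun t : ℝ => X.1 (t : Circ)) (2 * Real.pi) := by
    intro t
    rw [← deriv_comp_add_const]
    simp
  ⟨hper.lift, by
    have h : ContDiff ℝ ∞ (deriv fun t : ℝ => X.1 (t : Circ)) :=
      (contDiff_infty_iff_deriv.1 (smoothLoops.contDiff X)).2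
    exact h⟩

/-- The pointwise bracket of smooth loops. -/
def smoothLoops.lie [FiniteDimensional ℂ 𝔤] (X Y : smoothLoops 𝔤) : smoothLoops 𝔤 :=
  ⟨fun θ => ⁅X.1 θ, Y.1 θ⁆, by
    have hb := (LieModule.toEnd ℂ 𝔤 𝔤 :
      𝔤 →ₗ[ℂ] Module.End ℂ 𝔤).toContinuousBilinearMap.isBoundedBilinearMap
    have hb' := (hb.contDiff (n := ∞)).restrict_scalars ℝ
    exact hb'.comp (ContDiff.prodMk (smoothLoops.contDiff X) (smoothLoops.contDiff Y))⟩

/-- The pointwise involution `X*(θ) = X(θ)*` of smooth loops, so that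
`(x e^{inθ})* = x* e^{-inθ}`. -/
def smoothLoops.conj [StarAddMonoid 𝔤] [StarModule ℂ 𝔤] [NormedStarGroup 𝔤]
    (X : smoothLoops 𝔤) : smoothLoops 𝔤 :=
  ⟨fun θ => star (X.1 θ), (starL' ℝ : 𝔤 ≃L[ℝ] 𝔤).contDiff.comp (smoothLoops.contDiff X)⟩

/-- The cocycle `B(X, Y) = ∫ ⟨X, Ẏ⟩ dθ/2π`, where `⟨·,·⟩` is the basic inner product. -/
noncomputable def cocycle [FiniteDimensional ℂ 𝔤] [LieAlgebra.IsSimple ℂ 𝔤]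
    (𝔥 : LieSubalgebra ℂ 𝔤) [𝔥.IsCartanSubalgebra] (X Y : smoothLoops 𝔤) : ℂ :=
  ∫ θ, basicForm 𝔥 (X.1 θ) ((smoothLoops.dot Y).1 θ) ∂AddCircle.haarAddCircle

variable (𝔤) in
/-- `L²(S¹, 𝔤)`. -/
noncomputable abbrev L2Loops : Type _ :=
  Lp 𝔤 2 (AddCircle.haarAddCircle : Measure Circ)

end Loops

/-- Weighted square-summability is stable under addition. -/
theorem summable_weight_add {ι E : Type*} [NormedAddCommGroup E] {w : ι → ℝ} (hw : ∀ i, 0 ≤ w i)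
    {a b : ι → E} (ha : Summable fun i => w i * ‖a i‖ ^ 2)
    (hb : Summable fun i => w i * ‖b i‖ ^ 2) : Summable fun i => w i * ‖a i + b i‖ ^ 2 := by
  refine Summable.of_nonneg_of_le (fun i => mul_nonneg (hw i) (sq_nonneg _)) (fun i => ?_)
    ((ha.mul_left 2).add (hb.mul_left 2))
  have h1 : ‖a i + b i‖ ^ 2 ≤ 2 * ‖a i‖ ^ 2 + 2 * ‖b i‖ ^ 2 := by
    have h2 := norm_add_le (a i) (b i)
    have h3 := norm_nonneg (a i + b i)
    nlinarith [sq_nonneg (‖a i‖ - ‖b i‖)]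
  nlinarith [mul_le_mul_of_nonneg_left h1 (hw i)]

/-- Weighted square-summability is stable under scalar multiplication. -/
theorem summable_weight_smul {ι E : Type*} [NormedAddCommGroup E] [NormedSpace ℂ E] {w : ι → ℝ}
    (c : ℂ) {a : ι → E} (ha : Summable fun i => w i * ‖a i‖ ^ 2) :
    Summable fun i => w i * ‖c • a i‖ ^ 2 := by
  refine (ha.mul_left (‖c‖ ^ 2)).congr fun i => ?_
  rw [norm_smul]
  ring

section Sobolev

variable (𝔤 : Type*) [NormedLieRing 𝔤] [NormedLieAlgebra 𝔤]

/-- An `L²` loop is integrable against every character. -/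
theorem integrable_fourier_smul {E : Type*} [NormedAddCommGroup E] [NormedSpace ℂ E]
    (X : Lp E 2 (AddCircle.haarAddCircle : Measure Circ)) (k : ℤ) :
    Integrable (fun θ : Circ => fourier k θ • X θ) AddCircle.haarAddCircle := by
  have hX : Integrable X AddCircle.haarAddCircle := (Lp.memLp X).integrable (by norm_num)
  exact hX.bdd_smul 1 (by fun_prop) (Filter.Eventually.of_forall fun θ => by
    rw [fourier_apply]
    exact le_of_eq (Circle.norm_coe _))

/-- Fourier coefficients of `L²` loops are additive. -/
theorem fourierCoeff_Lp_add {E : Type*} [NormedAddCommGroup E] [NormedSpace ℂ E]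
    (X Y : Lp E 2 (AddCircle.haarAddCircle : Measure Circ)) (k : ℤ) :
    fourierCoeff (⇑(X + Y)) k = fourierCoeff X k + fourierCoeff Y k := by
  unfold fourierCoeff
  rw [← integral_add (integrable_fourier_smul X _) (integrable_fourier_smul Y _)]
  refine integral_congr_ae ?_
  filter_upwards [Lp.coeFn_add X Y] with θ h
  rw [h, Pi.add_apply, smul_add]

/-- Fourier coefficients of `L²` loops are homogeneous. -/
theorem fourierCoeff_Lp_smul {E : Type*} [NormedAddCommGroup E] [NormedSpace ℂ E]
    (c : ℂ) (X : Lp E 2 (AddCircle.haarAddCircle : Measure Circ)) (k : ℤ) :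
    fourierCoeff (⇑(c • X)) k = c • fourierCoeff X k := by
  unfold fourierCoeff
  rw [← integral_smul]
  refine integral_congr_ae ?_
  filter_upwards [Lp.coeFn_smul c X] with θ h
  rw [h, Pi.smul_apply, smul_comm]

/-- The Sobolev space `H^s(S¹, 𝔤)`, `s ≥ 0`: the `L²` loops `X = ∑ a_k e^{ikθ}` with
`∑ (1 + |k|)^{2s} ‖a_k‖² < ∞`. -/
noncomputable def sobolevLoops (s : ℝ) : Submodule ℂ (L2Loops 𝔤) where
  carrier := {X | Summable fun k : ℤ => (1 + |(k : ℝ)|) ^ (2 * s) * ‖fourierCoeff X k‖ ^ 2}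
  zero_mem' := by
    have h : ∀ k : ℤ, fourierCoeff (⇑(0 : L2Loops 𝔤)) k = 0 := fun k => by
      simpa using fourierCoeff_Lp_smul (0 : ℂ) (0 : L2Loops 𝔤) k
    simp only [Set.mem_ofPred_eq, h]
    simp [summable_zero]
  add_mem' {X Y} hX hY := by
    simp only [Set.mem_ofPred_eq, fourierCoeff_Lp_add] at *
    exact summable_weight_add (fun k => by positivity) hX hY
  smul_mem' c X hX := by
    simp only [Set.mem_ofPred_eq, fourierCoeff_Lp_smul] at *
    exact summable_weight_smul c hX

variable {𝔤}

/-- The norm `‖X‖_{H^s} = (∑ (1 + |k|)^{2s} ‖a_k‖²)^{1/2}`. -/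
noncomputable def sobolevLoops.norm {s : ℝ} (X : sobolevLoops 𝔤 s) : ℝ :=
  √(∑' k : ℤ, (1 + |(k : ℝ)|) ^ (2 * s) * ‖fourierCoeff X.1 k‖ ^ 2)

variable [StarAddMonoid 𝔤] [StarModule ℂ 𝔤] [NormedStarGroup 𝔤]

/-- The Fourier coefficients of `X*` are `a_{-k}*`. -/
theorem fourierCoeff_Lp_star [FiniteDimensional ℂ 𝔤] (X : L2Loops 𝔤) (k : ℤ) :
    fourierCoeff (⇑(star X)) k = star (fourierCoeff X (-k)) := by
  unfold fourierCoeff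
  have h1 := (starL' ℝ : 𝔤 ≃L[ℝ] 𝔤).integral_comp_comm
    (μ := (AddCircle.haarAddCircle : Measure Circ)) (fun θ : Circ => fourier (- -k) θ • X θ)
  rw [show star (∫ θ : Circ, fourier (- -k) θ • X θ ∂AddCircle.haarAddCircle)
    = (starL' ℝ : 𝔤 ≃L[ℝ] 𝔤) (∫ θ : Circ, fourier (- -k) θ • X θ ∂AddCircle.haarAddCircle)
    from rfl, ← h1]
  refine integral_congr_ae ?_
  filter_upwards [Lp.coeFn_star X] with θ h
  rw [h]
  simp [star_smul]

/-- The pointwise involution `X*(θ) = X(θ)*` on `H^s(S¹, 𝔤)`. -/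
noncomputable def sobolevLoops.conj [FiniteDimensional ℂ 𝔤] {s : ℝ} (X : sobolevLoops 𝔤 s) :
    sobolevLoops 𝔤 s :=
  ⟨star X.1, by
    have hX : Summable fun k : ℤ => (1 + |(k : ℝ)|) ^ (2 * s) * ‖fourierCoeff X.1 k‖ ^ 2 := X.2
    have h2 := (Equiv.neg ℤ).summable_iff.2 hX
    refine h2.congr fun k => ?_
    rw [fourierCoeff_Lp_star, norm_star]
    simp⟩

/-- `X` lies in `H^s(S¹, 𝔤₀)`, where `𝔤₀ = {x | x* = -x}`. -/
def sobolevLoops.IsRealFormValued {s : ℝ} (X : sobolevLoops 𝔤 s) : Prop :=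
  ∀ᵐ θ ∂(AddCircle.haarAddCircle : Measure Circ), star (X.1 θ) = -(X.1 θ)

end Sobolev

/-- `Y'` is the weak derivative `dY/dθ` of `Y`, for `L²` loops. -/
def IsWeakDeriv {𝔤 : Type*} [NormedLieRing 𝔤] [NormedLieAlgebra 𝔤] (Y Y' : L2Loops 𝔤) : Prop :=
  ∀ k : ℤ, fourierCoeff Y' k = (Complex.I * k) • fourierCoeff Y k

/-! ## Positive energy Hilbert spaces -/

/-- A decomposition `H = ⨁_{n ≥ 0} H(n)` of a Hilbert space into finite-dimensional, mutually
orthogonal energy spaces, with `H(0) ≠ 0`. Equivalently: a strongly continuous unitary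
representation `θ ↦ e^{iθd}` of the circle group with spectrum in `{0, 1, 2, …}`, of finite type,
with `H(n)` the eigenspace of `d` for the eigenvalue `n`. -/
structure EnergyGrading (H : Type*) [NormedAddCommGroup H] [InnerProductSpace ℂ H]
    [CompleteSpace H] where
  /-- the energy space `H(n)` -/
  space : ℕ → Submodule ℂ H
  finite : ∀ n, FiniteDimensional ℂ (space n)
  isHilbertSum : IsHilbertSum ℂ (fun n => space n) fun n => (space n).subtypeₗᵢ
  zero_ne_bot : space 0 ≠ ⊥

namespace EnergyGrading

variable {H : Type*} [NormedAddCommGroup H] [InnerProductSpace ℂ H] [CompleteSpace H]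
  (E : EnergyGrading H)

instance instFinite (n : ℕ) : FiniteDimensional ℂ (E.space n) := E.finite n

/-- The orthogonal projection `P_n` of `H` onto `H(n)`. -/
noncomputable def proj (n : ℕ) : H →L[ℂ] H := (E.space n).starProjection

/-- The Sobolev space `H^s = D((1 + d)^s)`, `s ≥ 0`: the vectors `ξ` with
`∑ (1 + n)^{2s} ‖P_n ξ‖² < ∞`. -/
noncomputable def sobolev (s : ℝ) : Submodule ℂ H where
  carrier := {ξ | Summable fun n : ℕ => (1 + (n : ℝ)) ^ (2 * s) * ‖E.proj n ξ‖ ^ 2}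
  zero_mem' := by simp [summable_zero]
  add_mem' {ξ η} hξ hη := by
    simp only [Set.mem_ofPred_eq, map_add] at *
    exact summable_weight_add (fun n => by positivity) hξ hη
  smul_mem' c ξ hξ := by
    simp only [Set.mem_ofPred_eq, map_smul] at *
    exact summable_weight_smul c hξ

/-- The norm `‖ξ‖_s = ‖(1 + d)^s ξ‖ = (∑ (1 + n)^{2s} ‖P_n ξ‖²)^{1/2}` on `H^s`. -/
noncomputable def sobolevNorm (s : ℝ) (ξ : E.sobolev s) : ℝ :=
  √(∑' n : ℕ, (1 + (n : ℝ)) ^ (2 * s) * ‖E.proj n ξ‖ ^ 2)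

/-- The space `H^∞ = ⋂_k H^k` of smooth vectors. -/
noncomputable def smooth : Submodule ℂ H := ⨅ k : ℕ, E.sobolev k

/-- Membership in `H^∞`. -/
theorem mem_smooth {ξ : H} : ξ ∈ E.smooth ↔
    ∀ k : ℕ, Summable fun n : ℕ => (1 + (n : ℝ)) ^ (2 * (k : ℝ)) * ‖E.proj n ξ‖ ^ 2 := by
  simp only [smooth, Submodule.mem_iInf]
  rfl

/-- `∑ n P_n ξ` converges for `ξ` in `H^∞`. -/
theorem summable_energy (ξ : E.smooth) : Summable fun n : ℕ => (n : ℂ) • E.proj n (ξ : H) := by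
  have h1 := E.isHilbertSum.OrthogonalFamily.summable_iff_norm_sq_summable
    fun n => ((n : ℂ) • (E.space n).orthogonalProjectionOnto (ξ : H) : E.space n)
  have h2 : Summable fun n : ℕ =>
      ‖((n : ℂ) • (E.space n).orthogonalProjectionOnto (ξ : H) : E.space n)‖ ^ 2 := by
    refine Summable.of_nonneg_of_le (fun n => sq_nonneg _) (fun n => ?_)
      ((E.mem_smooth.1 ξ.2) 1)
    rw [norm_smul, mul_pow]
    refine mul_le_mul ?_ (le_of_eq rfl) (sq_nonneg _) (by positivity)
    have h3 : (1 + (n : ℝ)) ^ (2 * ((1 : ℕ) : ℝ)) = (1 + (n : ℝ)) ^ 2 := by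
      rw [← Real.rpow_natCast]
      norm_num
    rw [h3, Complex.norm_natCast]
    gcongr
    linarith
  exact h1.2 h2

/-- `P_m ∑ n P_n ξ = m P_m ξ`. -/
theorem proj_tsum_energy (ξ : E.smooth) (m : ℕ) :
    E.proj m (∑' n : ℕ, (n : ℂ) • E.proj n (ξ : H)) = (m : ℂ) • E.proj m (ξ : H) := by
  rw [(E.proj m).map_tsum (E.summable_energy ξ), tsum_eq_single m]
  · rw [map_smul]
    congr 1
    exact Submodule.starProjection_eq_self_iff.2 (Submodule.starProjection_apply_mem _ _)
  · intro n hn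
    rw [map_smul]
    have h : E.proj m (E.proj n (ξ : H)) = 0 := by
      refine (Submodule.starProjection_apply_eq_zero_iff _).2 ?_
      rw [Submodule.mem_orthogonal]
      intro u hu
      exact E.isHilbertSum.OrthogonalFamily hn.symm ⟨u, hu⟩
        ⟨_, Submodule.starProjection_apply_mem (E.space n) (ξ : H)⟩
    rw [h, smul_zero]

/-- The generator of rotations `d` on `H^∞`: `d ξ = ∑ n P_n ξ`. -/
noncomputable def energy : E.smooth →ₗ[ℂ] E.smooth where
  toFun ξ := ⟨∑' n : ℕ, (n : ℂ) • E.proj n (ξ : H), by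
    refine E.mem_smooth.2 fun k => ?_
    refine Summable.of_nonneg_of_le (fun n => by positivity) (fun n => ?_)
      ((E.mem_smooth.1 ξ.2) (k + 1))
    rw [E.proj_tsum_energy, norm_smul, mul_pow, Complex.norm_natCast, ← mul_assoc]
    refine mul_le_mul_of_nonneg_right ?_ (sq_nonneg _)
    have h1 : (1 + (n : ℝ)) ^ (2 * ((k + 1 : ℕ) : ℝ))
        = (1 + (n : ℝ)) ^ (2 * (k : ℝ)) * (1 + (n : ℝ)) ^ 2 := by
      rw [← Real.rpow_natCast (1 + (n : ℝ)) 2, ← Real.rpow_add (by positivity)]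
      congr 1
      push_cast
      ring
    rw [h1]
    gcongr
    linarith⟩
  map_add' ξ η := by
    refine Subtype.ext ?_
    simp only [Submodule.coe_add, map_add, smul_add]
    exact (E.summable_energy ξ).tsum_add (E.summable_energy η)
  map_smul' c ξ := by
    refine Subtype.ext ?_
    simp only [Submodule.coe_smul, map_smul, RingHom.id_apply]
    rw [← (E.summable_energy ξ).tsum_const_smul]
    exact tsum_congr fun n => smul_comm _ _ _

end EnergyGrading

/-! ## Positive energy representations of the loop algebra -/

/-- A positive energy representation of finite type of the loop algebra `L𝔤` on `H`: a rotation
representation with generator `d ≥ 0` and a projective representation `π` of `L𝔤 = C^∞(S¹, 𝔤)` on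
the space `H^∞` of smooth vectors, of level `ℓ`, unitary with respect to the involution of `L𝔤`
and covariant under rotations. -/
structure PositiveEnergyRep (𝔤 : Type*) [NormedLieRing 𝔤] [NormedLieAlgebra 𝔤]
    [FiniteDimensional ℂ 𝔤] [LieAlgebra.IsSimple ℂ 𝔤]
    [StarAddMonoid 𝔤] [StarModule ℂ 𝔤] [NormedStarGroup 𝔤]
    (𝔥 : LieSubalgebra ℂ 𝔤) [𝔥.IsCartanSubalgebra]
    (H : Type*) [NormedAddCommGroup H] [InnerProductSpace ℂ H] [CompleteSpace H]
    extends EnergyGrading H where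
  /-- the level `ℓ` -/
  level : ℝ
  /-- the operators `π(X)` on `H^∞` -/
  op : smoothLoops 𝔤 →ₗ[ℂ] Module.End ℂ toEnergyGrading.smooth
  /-- `[π(X), π(Y)] = π([X, Y]) + iℓ B(X, Y)` -/
  commutator : ∀ X Y : smoothLoops 𝔤,
    op X * op Y - op Y * op X = op (smoothLoops.lie X Y) + (Complex.I * level * cocycle 𝔥 X Y) • 1
  /-- `[d, π(X)] = i π(Ẋ)` -/
  energy_commutator : ∀ X : smoothLoops 𝔤,
    toEnergyGrading.energy * op X - op X * toEnergyGrading.energy = Complex.I • op (smoothLoops.dot X)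
  /-- `π(X*)` is the formal adjoint of `π(X)` on `H^∞` -/
  formal_adjoint : ∀ (X : smoothLoops 𝔤) (ξ η : toEnergyGrading.smooth),
    ⟪(ξ : H), (op X η : H)⟫_ℂ = ⟪(op (smoothLoops.conj X) ξ : H), (η : H)⟫_ℂ

/-! ## Unbounded operators -/

/-- A linear map defined on a subspace `D` of `H`, as an unbounded operator on `H` with
domain `D`. -/
def toUnbounded {H : Type*} [NormedAddCommGroup H] [InnerProductSpace ℂ H] {D : Submodule ℂ H}
    (T : D →ₗ[ℂ] H) : H →ₗ.[ℂ] H :=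
  ⟨D, T⟩

/-- A densely defined closable operator whose closure is skew-adjoint. -/
def IsEssentiallySkewAdjoint {H : Type*} [NormedAddCommGroup H] [InnerProductSpace ℂ H]
    [CompleteSpace H] (T : H →ₗ.[ℂ] H) : Prop :=
  Dense (T.domain : Set H) ∧ T.IsClosable ∧ T.closure.adjoint = -T.closure

end LoopAlgebra

open LoopAlgebra

/-!
The operators `x(k) = π(e^{ikθ} x)` map `H(n)` to `H(n - k)`, and everything rests on an energy
bound for them with constants uniform in `k`: from `H(n)` to `H(m)`, the norm of `x(k)` is
`O(‖x‖ (1 + max(n, m))^{1/2})` (`PositiveEnergyRep.exists_mode_bound`).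

* For Hermitian `x` the modes `x(k)` satisfy the Heisenberg relations, because `[x, x] = 0`. An
  induction on the energy gives `∑_{k ≥ 1} x(k)* x(k) ≤ c d` with `c = |ℓ ⟨x, x⟩|`
  (`PositiveEnergyRep.sum_norm_modeOp_sq_le`); this bounds all nonzero modes, since every
  element of `𝔤` is of the form `a + ib` with `a` and `b` Hermitian.
* The zero modes of brackets are averages of `[y(k), z(-k)] - ℓ k ⟨y, z⟩` over `1 ≤ k ≤ K`. The
  sums over `k` are controlled by the previous bound, and `K ~ √n` yields `O(√n)` on `H(n)`
  (`PositiveEnergyRep.exists_zero_mode_bound_lie`). As `𝔤` is simple, brackets span `𝔤`.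

For `X = ∑ a_k e^{ikθ}` in `H^{3/2}` the series `∑ a_k(k) (1 + d)^{-1/2}` then converges in norm
by the Cauchy-Schwarz inequality, and composing with `(1 + d)^{1/2}` defines the extension
(`PositiveEnergyRep.sobolevOp`). Identities between these operators need only be checked on the
energy spaces. There the commutation relations follow from those of the modes and from the
convolution formula for the Fourier coefficients of a product. No continuity of `X ↦ π(X)` on
smooth loops is presupposed: the matrix element of `π(X)` from `H(n)` to `H(m)` depends only on
the Fourier coefficient of `X` of index `k = n - m`, because a smooth loop without that
coefficient has the form `Ẏ - ik Y`, and `[d, π(Y)] = i π(Ẏ)` (`PositiveEnergyRep.proj_op`).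

For the adjoint, let `F_N` be the Fejér means of the expansion in energy spaces. A difference of
Fejér weights compensates the growth of the modes, so that `[π(X), F_N]` is bounded on `H`
uniformly in `N` (`PositiveEnergyRep.norm_fejer_commutator_le`). If `ζ` lies in the domain of
`π(X)*`, the vectors `F_N ζ` lie in `H^{1/2}`, and the uniform bound shows that `π(X*) F_N ζ`
tends to `π(X)* ζ` (`PositiveEnergyRep.tendsto_sobolevOp_conj_fejer`); hence `π(X)*` is the
closure of `π(X*)`.
-/

namespace LoopAlgebra

/-! ### Orthogonal series -/

section OrthogonalSeries

variable {ι H : Type*} [NormedAddCommGroup H] [InnerProductSpace ℂ H]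

theorem orthogonalFamily_span {f : ι → H} (ho : Pairwise fun i j => ⟪f i, f j⟫_ℂ = 0) :
    OrthogonalFamily ℂ (fun i => (ℂ ∙ f i : Submodule ℂ H))
      fun i => (ℂ ∙ f i : Submodule ℂ H).subtypeₗᵢ := by
  intro i j hij v w
  obtain ⟨a, ha⟩ := Submodule.mem_span_singleton.1 v.2
  obtain ⟨b, hb⟩ := Submodule.mem_span_singleton.1 w.2
  change ⟪(v : H), (w : H)⟫_ℂ = 0
  rw [← ha, ← hb, inner_smul_left, inner_smul_right, ho hij, mul_zero, mul_zero]

theorem norm_sum_sq_of_orthogonal {f : ι → H}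
    (ho : Pairwise fun i j => ⟪f i, f j⟫_ℂ = 0) (s : Finset ι) :
    ‖∑ i ∈ s, f i‖ ^ 2 = ∑ i ∈ s, ‖f i‖ ^ 2 := by
  exact (orthogonalFamily_span ho).norm_sum (fun i => ⟨f i, Submodule.mem_span_singleton_self _⟩) s

theorem summable_of_orthogonal [CompleteSpace H] {f : ι → H}
    (ho : Pairwise fun i j => ⟪f i, f j⟫_ℂ = 0) (hs : Summable fun i => ‖f i‖ ^ 2) :
    Summable f := by
  exact ((orthogonalFamily_span ho).summable_iff_norm_sq_summable
    fun i => ⟨f i, Submodule.mem_span_singleton_self _⟩).2 hs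

theorem norm_sq_le_of_hasSum_orthogonal {f : ι → H} {v : H} {a : ι → ℝ} {b : ℝ}
    (ho : Pairwise fun i j => ⟪f i, f j⟫_ℂ = 0) (hf : HasSum f v)
    (hle : ∀ i, ‖f i‖ ^ 2 ≤ a i) (ha : HasSum a b) : ‖v‖ ^ 2 ≤ b := by
  refine le_of_tendsto (hf.norm.pow 2) (Filter.Eventually.of_forall fun s => ?_)
  rw [norm_sum_sq_of_orthogonal ho]
  exact (Finset.sum_le_sum fun i _ => hle i).trans
    (sum_le_hasSum s (fun i _ => (sq_nonneg _).trans (hle i)) ha)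

theorem norm_sq_of_hasSum_orthogonal {f : ι → H} {v : H}
    (ho : Pairwise fun i j => ⟪f i, f j⟫_ℂ = 0) (hf : HasSum f v) :
    HasSum (fun i => ‖f i‖ ^ 2) (‖v‖ ^ 2) := by
  refine (hf.norm.pow 2).congr fun s => ?_
  exact (norm_sum_sq_of_orthogonal ho s)

end OrthogonalSeries

/-! ### Energy spaces -/

namespace EnergyGrading

variable {H : Type*} [NormedAddCommGroup H] [InnerProductSpace ℂ H] [CompleteSpace H]
  (E : EnergyGrading H)

theorem proj_mem (n : ℕ) (ξ : H) : E.proj n ξ ∈ E.space n :=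
  Submodule.starProjection_apply_mem _ _

theorem proj_of_mem {n : ℕ} {ξ : H} (h : ξ ∈ E.space n) : E.proj n ξ = ξ :=
  Submodule.starProjection_eq_self_iff.2 h

theorem inner_eq_zero {m n : ℕ} (hmn : m ≠ n) {ξ η : H} (hξ : ξ ∈ E.space m)
    (hη : η ∈ E.space n) : ⟪ξ, η⟫_ℂ = 0 :=
  E.isHilbertSum.OrthogonalFamily hmn ⟨ξ, hξ⟩ ⟨η, hη⟩

theorem proj_of_mem_ne {m n : ℕ} (hmn : m ≠ n) {ξ : H} (h : ξ ∈ E.space n) :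
    E.proj m ξ = 0 :=
  (Submodule.starProjection_apply_eq_zero_iff _).2
    ((Submodule.mem_orthogonal _ _).2 fun _ hu => E.inner_eq_zero hmn hu h)

theorem inner_proj_left (n : ℕ) (ξ η : H) : ⟪E.proj n ξ, η⟫_ℂ = ⟪ξ, E.proj n η⟫_ℂ :=
  Submodule.inner_starProjection_left_eq_right _ _ _

theorem pairwise_orthogonal_proj (ξ : H) :
    Pairwise fun m n => ⟪E.proj m ξ, E.proj n ξ⟫_ℂ = 0 :=
  fun _ _ hmn => E.inner_eq_zero hmn (E.proj_mem _ _) (E.proj_mem _ _)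

theorem hasSum_proj (ξ : H) : HasSum (fun n => E.proj n ξ) ξ := by
  have h := E.isHilbertSum.hasSum_linearIsometryEquiv_symm
    (E.isHilbertSum.linearIsometryEquiv ξ)
  rw [LinearIsometryEquiv.symm_apply_apply] at h
  set w := E.isHilbertSum.linearIsometryEquiv ξ
  refine h.congr_fun fun n => ?_
  have h1 := (h.mapL (E.proj n)).unique (hasSum_single n fun m hm => ?_)
  · rw [h1]
    exact E.proj_of_mem (w n).2
  · exact E.proj_of_mem_ne hm.symm (w m).2

theorem hasSum_norm_sq (ξ : H) : HasSum (fun n => ‖E.proj n ξ‖ ^ 2) (‖ξ‖ ^ 2) :=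
  norm_sq_of_hasSum_orthogonal (E.pairwise_orthogonal_proj ξ) (E.hasSum_proj ξ)

theorem ext_proj {ξ η : H} (h : ∀ n, E.proj n ξ = E.proj n η) : ξ = η :=
  (E.hasSum_proj ξ).unique ((E.hasSum_proj η).congr_fun h)

theorem mem_space_of_proj {n : ℕ} {ξ : H} (h : ∀ m, m ≠ n → E.proj m ξ = 0) :
    ξ ∈ E.space n := by
  have h1 : ξ = E.proj n ξ := (E.hasSum_proj ξ).unique (hasSum_single n h)
  rw [h1]
  exact E.proj_mem _ _

theorem mem_sobolev_of_mem {n : ℕ} (s : ℝ) {ξ : H} (h : ξ ∈ E.space n) : ξ ∈ E.sobolev s := by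
  refine summable_of_ne_finset_zero (s := {n}) fun m hm => ?_
  rw [E.proj_of_mem_ne (by simpa using hm) h]
  simp

theorem mem_smooth_of_mem {n : ℕ} {ξ : H} (h : ξ ∈ E.space n) : ξ ∈ E.smooth :=
  (Submodule.mem_iInf _).2 fun k => E.mem_sobolev_of_mem k h

theorem smooth_le_sobolev_half : E.smooth ≤ E.sobolev (1 / 2) := by
  intro ξ hξ
  refine Summable.of_nonneg_of_le (fun n => by positivity) (fun n => ?_) (E.mem_smooth.1 hξ 1)
  gcongr
  · linarith [n.cast_nonneg (α := ℝ)]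
  · norm_num

/-- The projection onto `H(n)`, with values in `H^∞`. -/
noncomputable def projSmooth (n : ℕ) : H →ₗ[ℂ] E.smooth :=
  (E.proj n : H →ₗ[ℂ] H).codRestrict E.smooth fun ξ => E.mem_smooth_of_mem (E.proj_mem n ξ)

@[simp] theorem coe_projSmooth (n : ℕ) (ξ : H) : (E.projSmooth n ξ : H) = E.proj n ξ := rfl

/-- The projection onto `H(n)`, with values in `H^s`. -/
noncomputable def projSobolev (s : ℝ) (n : ℕ) : H →ₗ[ℂ] E.sobolev s :=
  (E.proj n : H →ₗ[ℂ] H).codRestrict (E.sobolev s) fun ξ =>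
    E.mem_sobolev_of_mem s (E.proj_mem n ξ)

@[simp] theorem coe_projSobolev (s : ℝ) (n : ℕ) (ξ : H) :
    (E.projSobolev s n ξ : H) = E.proj n ξ := rfl

theorem energy_of_mem {n : ℕ} {ξ : E.smooth} (h : (ξ : H) ∈ E.space n) :
    E.energy ξ = (n : ℂ) • ξ := by
  refine Subtype.ext (E.ext_proj fun m => ?_)
  have h1 : E.proj m (E.energy ξ : H) = (m : ℂ) • E.proj m (ξ : H) := E.proj_tsum_energy ξ m
  rw [h1, Submodule.coe_smul, map_smul]
  rcases eq_or_ne m n with rfl | hmn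
  · rfl
  · rw [E.proj_of_mem_ne hmn h, smul_zero, smul_zero]

theorem proj_energy (ξ : E.smooth) (m : ℕ) :
    E.proj m (E.energy ξ : H) = (m : ℂ) • E.proj m (ξ : H) := E.proj_tsum_energy ξ m

theorem weight_half (n : ℕ) : (1 + (n : ℝ)) ^ (2 * (1 / 2 : ℝ)) = 1 + (n : ℝ) := by norm_num

theorem summable_of_sobolev_half (ξ : E.sobolev (1 / 2)) :
    Summable fun n : ℕ => (1 + (n : ℝ)) * ‖E.proj n (ξ : H)‖ ^ 2 := by
  have h : Summable fun n : ℕ => (1 + (n : ℝ)) ^ (2 * (1 / 2 : ℝ)) * ‖E.proj n (ξ : H)‖ ^ 2 := ξ.2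
  simpa only [weight_half] using h

theorem summable_sqrtEnergy (ξ : E.sobolev (1 / 2)) :
    Summable fun n : ℕ => ((√(1 + (n : ℝ)) : ℝ) : ℂ) • E.proj n (ξ : H) := by
  refine summable_of_orthogonal (fun m n hmn => ?_) ?_
  · beta_reduce
    rw [inner_smul_left, inner_smul_right, E.pairwise_orthogonal_proj _ hmn, mul_zero, mul_zero]
  · refine (E.summable_of_sobolev_half ξ).congr fun n => ?_
    rw [norm_smul, mul_pow, Complex.norm_real, Real.norm_of_nonneg (Real.sqrt_nonneg _),
      Real.sq_sqrt (by positivity)]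

/-- The operator `(1 + d)^{1/2}` from `H^{1/2}` to `H`. -/
noncomputable def sqrtEnergy : E.sobolev (1 / 2) →ₗ[ℂ] H where
  toFun ξ := ∑' n : ℕ, ((√(1 + (n : ℝ)) : ℝ) : ℂ) • E.proj n (ξ : H)
  map_add' ξ η := by
    simp only [Submodule.coe_add, map_add, smul_add]
    exact (E.summable_sqrtEnergy ξ).tsum_add (E.summable_sqrtEnergy η)
  map_smul' c ξ := by
    simp only [Submodule.coe_smul, map_smul, RingHom.id_apply]
    rw [← (E.summable_sqrtEnergy ξ).tsum_const_smul]
    exact tsum_congr fun n => smul_comm _ _ _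

theorem proj_sqrtEnergy (ξ : E.sobolev (1 / 2)) (n : ℕ) :
    E.proj n (E.sqrtEnergy ξ) = ((√(1 + (n : ℝ)) : ℝ) : ℂ) • E.proj n (ξ : H) := by
  refine ((E.summable_sqrtEnergy ξ).hasSum.mapL (E.proj n)).unique ?_
  convert hasSum_single n fun m hm => ?_ using 1
  · rw [map_smul, E.proj_of_mem (E.proj_mem _ _)]
  · rw [map_smul, E.proj_of_mem_ne hm.symm (E.proj_mem _ _), smul_zero]

theorem norm_sqrtEnergy (ξ : E.sobolev (1 / 2)) :
    ‖E.sqrtEnergy ξ‖ = E.sobolevNorm (1 / 2) ξ := by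
  rw [sobolevNorm, eq_comm, Real.sqrt_eq_iff_mul_self_eq (tsum_nonneg fun n => by positivity)
    (norm_nonneg _), ← pow_two, ← (E.hasSum_norm_sq _).tsum_eq]
  refine tsum_congr fun n => ?_
  rw [E.proj_sqrtEnergy, norm_smul, mul_pow, Complex.norm_real,
    Real.norm_of_nonneg (Real.sqrt_nonneg _), Real.sq_sqrt (by positivity), weight_half]

theorem sqrtEnergy_projSobolev (ξ : E.sobolev (1 / 2)) (n : ℕ) :
    E.sqrtEnergy (E.projSobolev _ n ξ) = E.proj n (E.sqrtEnergy ξ) := by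
  refine E.ext_proj fun m => ?_
  rw [E.proj_sqrtEnergy, E.coe_projSobolev]
  rcases eq_or_ne m n with rfl | hmn
  · rw [E.proj_of_mem (E.proj_mem _ _), E.proj_of_mem (E.proj_mem _ _), E.proj_sqrtEnergy]
  · rw [E.proj_of_mem_ne hmn (E.proj_mem _ _), E.proj_of_mem_ne hmn (E.proj_mem _ _), smul_zero]

/-! ### Operators given on the energy spaces -/

/-- Operators `A_n` that factor through the projections `P_n`, are uniformly bounded by them and
have mutually orthogonal ranges add up to a bounded operator. -/
theorem exists_sum_blocks (A : ℕ → H →ₗ[ℂ] H) {C : ℝ} (hC : 0 ≤ C)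
    (hle : ∀ n ξ, ‖A n ξ‖ ≤ C * ‖E.proj n ξ‖)
    (ho : ∀ ξ, Pairwise fun m n => ⟪A m ξ, A n ξ⟫_ℂ = 0) :
    ∃ T : H →L[ℂ] H, ‖T‖ ≤ C ∧ ∀ ξ, HasSum (fun n => A n ξ) (T ξ) := by
  have hle2 : ∀ ξ n, ‖A n ξ‖ ^ 2 ≤ C ^ 2 * ‖E.proj n ξ‖ ^ 2 := fun ξ n => by
    rw [← mul_pow]
    exact pow_le_pow_left₀ (norm_nonneg _) (hle n ξ) 2
  have hs : ∀ ξ, Summable fun n => A n ξ := fun ξ =>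
    summable_of_orthogonal (ho ξ) (Summable.of_nonneg_of_le (fun n => sq_nonneg _) (hle2 ξ)
      ((E.hasSum_norm_sq ξ).summable.mul_left _))
  let T : H →ₗ[ℂ] H :=
    { toFun := fun ξ => ∑' n, A n ξ
      map_add' := fun ξ η => by
        simp only [map_add]
        exact (hs ξ).tsum_add (hs η)
      map_smul' := fun c ξ => by
        simp only [map_smul, RingHom.id_apply]
        exact (hs ξ).tsum_const_smul c }
  have hT : ∀ ξ, ‖T ξ‖ ≤ C * ‖ξ‖ := fun ξ => by
    refine le_of_sq_le_sq ?_ (by positivity)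
    rw [mul_pow]
    exact norm_sq_le_of_hasSum_orthogonal (ho ξ) (hs ξ).hasSum (hle2 ξ)
      ((E.hasSum_norm_sq ξ).mul_left _)
  exact ⟨T.mkContinuous C hT, T.mkContinuous_norm_le hC hT, fun ξ => (hs ξ).hasSum⟩

end EnergyGrading

/-! ### Smooth loops and their Fourier coefficients -/

section SmoothLoops

variable {𝔤 : Type*} [NormedLieRing 𝔤] [NormedLieAlgebra 𝔤]

theorem smoothLoops.dot_coe (X : smoothLoops 𝔤) (t : ℝ) :
    (smoothLoops.dot X).1 (t : Circ) = deriv (fun s : ℝ => X.1 (s : Circ)) t := rfl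

theorem smoothLoops.hasDerivAt (X : smoothLoops 𝔤) (t : ℝ) :
    HasDerivAt (fun s : ℝ => X.1 (s : Circ)) ((smoothLoops.dot X).1 (t : Circ)) t := by
  rw [smoothLoops.dot_coe]
  exact ((smoothLoops.contDiff X).differentiable (by simp) t).hasDerivAt

theorem smoothLoops.ext_real {X Y : smoothLoops 𝔤}
    (h : ∀ t : ℝ, X.1 (t : Circ) = Y.1 (t : Circ)) : X = Y := by
  refine Subtype.ext (funext fun θ => ?_)
  induction θ using QuotientAddGroup.induction_on with
  | H t => exact h t

theorem smoothLoops.dot_eq_of_hasDerivAt {X Y : smoothLoops 𝔤}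
    (h : ∀ t : ℝ, HasDerivAt (fun s : ℝ => X.1 (s : Circ)) (Y.1 (t : Circ)) t) :
    smoothLoops.dot X = Y :=
  smoothLoops.ext_real fun t => (smoothLoops.hasDerivAt X t).unique (h t)

theorem smoothLoops.continuous (X : smoothLoops 𝔤) : Continuous X.1 :=
  (QuotientAddGroup.isOpenQuotientMap_mk.isQuotientMap.continuous_iff).2
    (smoothLoops.contDiff X).continuous

theorem hasDerivAt_fourier_coe (k : ℤ) (t : ℝ) :
    HasDerivAt (fun s : ℝ => fourier k (s : Circ)) (Complex.I * k * fourier k (t : Circ)) t := by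
  convert hasDerivAt_fourier (2 * Real.pi) k t using 1
  have : (Real.pi : ℂ) ≠ 0 := by exact_mod_cast Real.pi_ne_zero
  push_cast
  field_simp

theorem contDiff_fourier_coe (k : ℤ) : ContDiff ℝ ∞ fun s : ℝ => fourier k (s : Circ) := by
  simp only [fourier_coe_apply]
  have h : ContDiff ℝ ∞ fun s : ℝ => (s : ℂ) := Complex.ofRealCLM.contDiff
  exact ((contDiff_const.mul h).div_const _).cexp

/-- The product `e^{ikθ} X` of a character and a smooth loop. -/
noncomputable def smoothLoops.twist (k : ℤ) (X : smoothLoops 𝔤) : smoothLoops 𝔤 :=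
  ⟨fun θ => fourier k θ • X.1 θ, (contDiff_fourier_coe k).smul (smoothLoops.contDiff X)⟩

theorem smoothLoops.dot_twist (k : ℤ) (X : smoothLoops 𝔤) :
    smoothLoops.dot (smoothLoops.twist k X)
      = (Complex.I * k) • smoothLoops.twist k X + smoothLoops.twist k (smoothLoops.dot X) := by
  refine smoothLoops.dot_eq_of_hasDerivAt fun t => ?_
  refine ((hasDerivAt_fourier_coe k t).smul (smoothLoops.hasDerivAt X t)).congr_deriv ?_
  change _ = (Complex.I * k) • fourier k (t : Circ) • X.1 t + fourier k (t : Circ) • _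
  rw [smul_smul, add_comm]

theorem integral_circ {F : Type*} [NormedAddCommGroup F] [NormedSpace ℂ F] (f : Circ → F) :
    ∫ θ, f θ ∂AddCircle.haarAddCircle
      = (1 / (2 * Real.pi) : ℝ) • ∫ t in (0 : ℝ)..(2 * Real.pi), f (t : Circ) := by
  have h := fourierCoeff_eq_intervalIntegral f 0 0
  simpa [fourierCoeff] using h

/-- The primitive of a smooth loop is periodic when the loop has mean zero. -/
theorem smoothLoops.exists_dot_eq [FiniteDimensional ℂ 𝔤] (W : smoothLoops 𝔤)
    (hW : ∫ θ, W.1 θ ∂AddCircle.haarAddCircle = 0) :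
    ∃ Z : smoothLoops 𝔤, smoothLoops.dot Z = W := by
  have : CompleteSpace 𝔤 := FiniteDimensional.complete ℂ 𝔤
  have hc : Continuous fun t : ℝ => W.1 (t : Circ) := (smoothLoops.contDiff W).continuous
  have hd : ∀ t : ℝ, HasDerivAt (fun t : ℝ => ∫ s in (0 : ℝ)..t, W.1 (s : Circ))
      (W.1 (t : Circ)) t := fun t => intervalIntegral.integral_hasDerivAt_right
    (hc.intervalIntegrable _ _) hc.stronglyMeasurable.stronglyMeasurableAtFilter hc.continuousAt
  have h0 : ∫ t in (0 : ℝ)..(2 * Real.pi), W.1 (t : Circ) = 0 := by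
    rw [integral_circ] at hW
    exact (smul_eq_zero.1 hW).resolve_left (by positivity)
  have hper : Function.Periodic (fun t : ℝ => ∫ s in (0 : ℝ)..t, W.1 (s : Circ))
      (2 * Real.pi) := by
    intro t
    have hp : Function.Periodic (fun s : ℝ => W.1 (s : Circ)) (2 * Real.pi) := fun s => by simp
    have h1 := hp.intervalIntegral_add_eq t 0
    rw [zero_add, h0] at h1
    beta_reduce
    rw [← intervalIntegral.integral_add_adjacent_intervals (hc.intervalIntegrable 0 t)
      (hc.intervalIntegrable t (t + 2 * Real.pi)), h1, add_zero]
  have hs : ContDiff ℝ ∞ fun t : ℝ => ∫ s in (0 : ℝ)..t, W.1 (s : Circ) := by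
    refine contDiff_infty_iff_deriv.2 ⟨fun t => (hd t).differentiableAt, ?_⟩
    rw [funext fun t => (hd t).deriv]
    exact smoothLoops.contDiff W
  exact ⟨⟨hper.lift, hs⟩, smoothLoops.dot_eq_of_hasDerivAt hd⟩

/-- The equation `Ẏ - ik Y = X` is solved by `Y = e^{ikθ} Z`, where `Z` is a primitive of the loop
`e^{-ikθ} X` of mean zero. -/
theorem smoothLoops.exists_dot_sub_eq [FiniteDimensional ℂ 𝔤] (X : smoothLoops 𝔤) (k : ℤ)
    (hX : fourierCoeff X.1 k = 0) :
    ∃ Y : smoothLoops 𝔤, smoothLoops.dot Y - (Complex.I * k) • Y = X := by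
  obtain ⟨Z, hZ⟩ := smoothLoops.exists_dot_eq (smoothLoops.twist (-k) X) hX
  refine ⟨smoothLoops.twist k Z, ?_⟩
  rw [smoothLoops.dot_twist, hZ, add_sub_cancel_left]
  refine Subtype.ext (funext fun θ => ?_)
  change fourier k θ • fourier (-k) θ • X.1 θ = X.1 θ
  rw [smul_smul, ← fourier_add, add_neg_cancel, fourier_zero, one_smul]

theorem smoothLoops.integral_dot [FiniteDimensional ℂ 𝔤] (X : smoothLoops 𝔤) :
    ∫ θ, (smoothLoops.dot X).1 θ ∂AddCircle.haarAddCircle = 0 := by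
  have : CompleteSpace 𝔤 := FiniteDimensional.complete ℂ 𝔤
  rw [integral_circ, intervalIntegral.integral_eq_sub_of_hasDerivAt
    (fun t _ => smoothLoops.hasDerivAt X t)
    ((smoothLoops.contDiff (smoothLoops.dot X)).continuous.intervalIntegrable _ _),
    show ((2 * Real.pi : ℝ) : Circ) = ((0 : ℝ) : Circ) from by simp [AddCircle.coe_period],
    sub_self, smul_zero]

theorem smoothLoops.integrable (X : smoothLoops 𝔤) :
    Integrable X.1 (AddCircle.haarAddCircle : Measure Circ) :=
  (smoothLoops.continuous X).integrable_of_hasCompactSupport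
    (HasCompactSupport.of_compactSpace _)

theorem smoothLoops.fourierCoeff_dot [FiniteDimensional ℂ 𝔤] (X : smoothLoops 𝔤) (k : ℤ) :
    fourierCoeff (smoothLoops.dot X).1 k = (Complex.I * k) • fourierCoeff X.1 k := by
  have h := smoothLoops.integral_dot (smoothLoops.twist (-k) X)
  rw [smoothLoops.dot_twist] at h
  have h2 := integral_add
    (smoothLoops.integrable ((Complex.I * ((-k : ℤ) : ℂ)) • smoothLoops.twist (-k) X))
    (smoothLoops.integrable (smoothLoops.twist (-k) (smoothLoops.dot X)))
  have h3 : ∫ θ, ((Complex.I * ((-k : ℤ) : ℂ)) • smoothLoops.twist (-k) X).1 θ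
      ∂AddCircle.haarAddCircle = (Complex.I * ((-k : ℤ) : ℂ)) • fourierCoeff X.1 k :=
    integral_smul _ _
  rw [h3] at h2
  have h4 : (Complex.I * ((-k : ℤ) : ℂ)) • fourierCoeff X.1 k
      + fourierCoeff (smoothLoops.dot X).1 k = 0 := h2.symm.trans h
  rw [eq_neg_of_add_eq_zero_right h4, ← neg_smul]
  push_cast
  ring_nf

theorem norm_fourierCoeff_le {F : Type*} [NormedAddCommGroup F] [NormedSpace ℂ F]
    (f : Circ → F) (k : ℤ) : ‖fourierCoeff f k‖ ≤ ∫ θ, ‖f θ‖ ∂AddCircle.haarAddCircle := by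
  refine (norm_integral_le_integral_norm _).trans (le_of_eq ?_)
  refine integral_congr_ae (Filter.Eventually.of_forall fun θ => ?_)
  beta_reduce
  rw [norm_smul, fourier_apply, Circle.norm_coe, one_mul]

/-- The Fourier coefficients of a smooth loop decay like `|k|⁻³`, so that it lies in `H^{3/2}`. -/
theorem smoothLoops.summable_fourierCoeff [FiniteDimensional ℂ 𝔤] (X : smoothLoops 𝔤) :
    Summable fun k : ℤ => (1 + |(k : ℝ)|) ^ (2 * (3 / 2 : ℝ)) * ‖fourierCoeff X.1 k‖ ^ 2 := by
  set X3 := smoothLoops.dot (smoothLoops.dot (smoothLoops.dot X))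
  set A := ∫ θ, ‖X.1 θ‖ ∂AddCircle.haarAddCircle
  set B := ∫ θ, ‖X3.1 θ‖ ∂AddCircle.haarAddCircle
  have hA : ∀ k, ‖fourierCoeff X.1 k‖ ≤ A := norm_fourierCoeff_le _
  have hB : ∀ k : ℤ, |(k : ℝ)| ^ 3 * ‖fourierCoeff X.1 k‖ ≤ B := fun k => by
    have h := norm_fourierCoeff_le X3.1 k
    rw [smoothLoops.fourierCoeff_dot, smoothLoops.fourierCoeff_dot,
      smoothLoops.fourierCoeff_dot, norm_smul, norm_smul, norm_smul, norm_mul, Complex.norm_I,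
      one_mul, Complex.norm_intCast] at h
    linarith [h]
  have hs : Summable fun k : ℤ => |(k : ℝ)| ^ (-2 : ℝ) :=
    Real.summable_abs_int_rpow (by norm_num)
  have hs2 : Summable fun k : ℤ => 8 * B ^ 2 * |(k : ℝ)| ^ (-2 : ℝ) := hs.mul_left _
  refine Summable.of_norm_bounded_eventually hs2 ?_
  have hfin : ({0} : Set ℤ).Finite := Set.finite_singleton 0
  filter_upwards [hfin.compl_mem_cofinite] with k hk
  have hk0 : k ≠ 0 := by simpa using hk
  have hk1 : (1 : ℝ) ≤ |(k : ℝ)| := by exact_mod_cast Int.one_le_abs hk0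
  rw [Real.norm_of_nonneg (by positivity)]
  have e1 : (1 + |(k : ℝ)|) ^ (2 * (3 / 2 : ℝ)) = (1 + |(k : ℝ)|) ^ 3 := by
    rw [← Real.rpow_natCast]
    norm_num
  have e2 : |(k : ℝ)| ^ (-2 : ℝ) = (|(k : ℝ)| ^ 2)⁻¹ := by
    rw [Real.rpow_neg (abs_nonneg _)]
    norm_num
  rw [e1, e2]
  set y := |(k : ℝ)|
  set a := ‖fourierCoeff X.1 k‖
  have h1 : (1 + y) ^ 3 ≤ 8 * y ^ 3 := by
    calc (1 + y) ^ 3 ≤ (2 * y) ^ 3 := by gcongr; linarith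
      _ = 8 * y ^ 3 := by ring
  have h2 : (y ^ 3 * a) ^ 2 ≤ B ^ 2 := pow_le_pow_left₀ (by positivity) (hB k) 2
  have hy : 0 < y := by linarith
  rw [← div_eq_mul_inv, le_div_iff₀ (by positivity)]
  calc (1 + y) ^ 3 * a ^ 2 * y ^ 2 ≤ 8 * y ^ 3 * a ^ 2 * y ^ 2 := by gcongr
    _ = 8 * (y ^ 5 * a ^ 2) := by ring
    _ ≤ 8 * (y ^ 6 * a ^ 2) := by
      gcongr
      · norm_num
    _ = 8 * (y ^ 3 * a) ^ 2 := by ring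
    _ ≤ 8 * B ^ 2 := by gcongr

theorem smoothLoops.exists_sobolevLoop [FiniteDimensional ℂ 𝔤] (X : smoothLoops 𝔤) :
    ∃ X' : sobolevLoops 𝔤 (3 / 2), X'.1 =ᵐ[AddCircle.haarAddCircle] X.1 := by
  have hm : MemLp X.1 2 (AddCircle.haarAddCircle : Measure Circ) :=
    (smoothLoops.continuous X).memLp_of_hasCompactSupport (HasCompactSupport.of_compactSpace _)
  refine ⟨⟨hm.toLp _, ?_⟩, hm.coeFn_toLp⟩
  have h := smoothLoops.summable_fourierCoeff X
  refine h.congr fun k => ?_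
  rw [fourierCoeff_congr_ae hm.coeFn_toLp]

end SmoothLoops

/-! ### Single Fourier modes -/

section Modes

variable {𝔤 : Type*} [NormedLieRing 𝔤] [NormedLieAlgebra 𝔤]

/-- The loop `e^{ikθ} x`. -/
noncomputable def smoothLoops.single (k : ℤ) : 𝔤 →ₗ[ℂ] smoothLoops 𝔤 where
  toFun x := ⟨fun θ => fourier k θ • x, (contDiff_fourier_coe k).smul contDiff_const⟩
  map_add' _ _ := Subtype.ext (funext fun _ => smul_add _ _ _)
  map_smul' _ _ := Subtype.ext (funext fun _ => smul_comm _ _ _)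

theorem smoothLoops.single_coe (k : ℤ) (x : 𝔤) (θ : Circ) :
    (smoothLoops.single k x).1 θ = fourier k θ • x := rfl

theorem smoothLoops.dot_single (k : ℤ) (x : 𝔤) :
    smoothLoops.dot (smoothLoops.single k x) = (Complex.I * k) • smoothLoops.single k x := by
  refine smoothLoops.dot_eq_of_hasDerivAt fun t => ?_
  refine ((hasDerivAt_fourier_coe k t).smul_const x).congr_deriv ?_
  exact mul_smul _ _ _

theorem smoothLoops.conj_single [StarAddMonoid 𝔤] [StarModule ℂ 𝔤] [NormedStarGroup 𝔤]
    (k : ℤ) (x : 𝔤) :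
    smoothLoops.conj (smoothLoops.single k x) = smoothLoops.single (-k) (star x) := by
  refine Subtype.ext (funext fun θ => ?_)
  change star (fourier k θ • x) = fourier (-k) θ • star x
  rw [star_smul, fourier_neg]
  rfl

theorem smoothLoops.lie_single [FiniteDimensional ℂ 𝔤] (k l : ℤ) (x y : 𝔤) :
    smoothLoops.lie (smoothLoops.single k x) (smoothLoops.single l y)
      = smoothLoops.single (k + l) ⁅x, y⁆ := by
  refine Subtype.ext (funext fun θ => ?_)
  change ⁅fourier k θ • x, fourier l θ • y⁆ = fourier (k + l) θ • ⁅x, y⁆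
  rw [smul_lie, lie_smul, smul_smul, fourier_add]

theorem smoothLoops.fourierCoeff_single [FiniteDimensional ℂ 𝔤] (k : ℤ) (x : 𝔤) :
    fourierCoeff (smoothLoops.single k x).1 k = x := by
  have : CompleteSpace 𝔤 := FiniteDimensional.complete ℂ 𝔤
  have h : ∀ θ : Circ, fourier (-k) θ • (smoothLoops.single k x).1 θ = x := fun θ => by
    rw [smoothLoops.single_coe, smul_smul, ← fourier_add, neg_add_cancel, fourier_zero, one_smul]
  simp only [fourierCoeff, h]
  simp

theorem integral_fourier (n : ℤ) :
    ∫ θ : Circ, fourier n θ ∂AddCircle.haarAddCircle = if n = 0 then 1 else 0 := by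
  have h := congrFun (fourierCoeff_fourier (T := 2 * Real.pi) n) 0
  simp only [fourierCoeff, neg_zero, fourier_zero, one_smul] at h
  rw [h, Pi.single_apply]
  simp [eq_comm]

theorem cocycle_single [FiniteDimensional ℂ 𝔤] [LieAlgebra.IsSimple ℂ 𝔤]
    (𝔥 : LieSubalgebra ℂ 𝔤) [𝔥.IsCartanSubalgebra] (k l : ℤ) (x y : 𝔤) :
    cocycle 𝔥 (smoothLoops.single k x) (smoothLoops.single l y)
      = if k + l = 0 then Complex.I * l * basicForm 𝔥 x y else 0 := by
  have h : ∀ θ : Circ, basicForm 𝔥 ((smoothLoops.single k x).1 θ)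
      ((smoothLoops.dot (smoothLoops.single l y)).1 θ)
      = Complex.I * l * basicForm 𝔥 x y * fourier (k + l) θ := fun θ => by
    rw [smoothLoops.dot_single]
    change basicForm 𝔥 (fourier k θ • x) ((Complex.I * l) • fourier l θ • y) = _
    simp only [map_smul, LinearMap.smul_apply, smul_eq_mul, fourier_add]
    ring
  rw [cocycle]
  simp only [h]
  rw [integral_const_mul, integral_fourier]
  split_ifs <;> simp

end Modes

namespace PositiveEnergyRep

variable {𝔤 : Type*} [NormedLieRing 𝔤] [NormedLieAlgebra 𝔤]
    [FiniteDimensional ℂ 𝔤] [LieAlgebra.IsSimple ℂ 𝔤]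
    [StarAddMonoid 𝔤] [StarModule ℂ 𝔤] [NormedStarGroup 𝔤]
    {𝔥 : LieSubalgebra ℂ 𝔤} [𝔥.IsCartanSubalgebra]
    {H : Type*} [NormedAddCommGroup H] [InnerProductSpace ℂ H] [CompleteSpace H]
    (π : PositiveEnergyRep 𝔤 𝔥 H)

/-- The operator `x(k) = π(e^{ikθ} x)` on `H^∞`. -/
noncomputable def modeOp (k : ℤ) : 𝔤 →ₗ[ℂ] Module.End ℂ π.smooth :=
  π.op.comp (smoothLoops.single k)

theorem inner_modeOp (k : ℤ) (x : 𝔤) (ξ η : π.smooth) :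
    ⟪ξ, π.modeOp k x η⟫_ℂ = ⟪π.modeOp (-k) (star x) ξ, η⟫_ℂ := by
  have h := π.formal_adjoint (smoothLoops.single k x) ξ η
  rw [smoothLoops.conj_single] at h
  exact h

theorem modeOp_commutator (k l : ℤ) (x y : 𝔤) (ξ : π.smooth) :
    π.modeOp k x (π.modeOp l y ξ) = π.modeOp l y (π.modeOp k x ξ) + π.modeOp (k + l) ⁅x, y⁆ ξ
      + (if k + l = 0 then (π.level * k * basicForm 𝔥 x y : ℂ) else 0) • ξ := by
  have h := congrArg (fun T : Module.End ℂ π.smooth => T ξ)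
    (π.commutator (smoothLoops.single k x) (smoothLoops.single l y))
  simp only [LinearMap.sub_apply, LinearMap.add_apply, Module.End.mul_apply, LinearMap.smul_apply,
    Module.End.one_apply, smoothLoops.lie_single, cocycle_single] at h
  have h2 : (if k + l = 0 then (π.level * k * basicForm 𝔥 x y : ℂ) else 0)
      = Complex.I * π.level * (if k + l = 0 then Complex.I * l * basicForm 𝔥 x y else 0) := by
    split_ifs with hkl
    · rw [show (k : ℂ) = -(l : ℂ) by rw [eq_neg_of_add_eq_zero_left hkl]; push_cast; ring]
      linear_combination (-(l : ℂ) * π.level * basicForm 𝔥 x y) * Complex.I_mul_I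
    · rw [mul_zero]
  rw [h2, add_assoc]
  exact sub_eq_iff_eq_add'.1 h

/-- `x(k)` maps `H(n)` to `H(n - k)`. -/
theorem proj_modeOp {k : ℤ} {x : 𝔤} {n m : ℕ} (hmn : (m : ℤ) + k ≠ n) {ξ : π.smooth}
    (hξ : (ξ : H) ∈ π.space n) : π.proj m (π.modeOp k x ξ : H) = 0 := by
  have h := congrArg (fun T : Module.End ℂ π.smooth => T ξ)
    (π.energy_commutator (smoothLoops.single k x))
  simp only [LinearMap.sub_apply, Module.End.mul_apply, LinearMap.smul_apply,
    smoothLoops.dot_single, map_smul] at h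
  rw [π.energy_of_mem hξ, map_smul, smul_smul, ← mul_assoc, Complex.I_mul_I] at h
  have h2 := congrArg (fun η : π.smooth => π.proj m (η : H)) h
  simp only [Submodule.coe_sub, Submodule.coe_smul, map_sub, map_smul, π.proj_energy] at h2
  rw [← sub_smul, ← sub_eq_zero, ← sub_smul] at h2
  refine (smul_eq_zero.1 h2).resolve_left fun h3 => hmn ?_
  have h4 : ((m : ℤ) + k : ℂ) = (n : ℤ) := by push_cast; linear_combination h3
  exact_mod_cast h4

theorem modeOp_mem {k : ℤ} (x : 𝔤) {n m : ℕ} (hmn : (m : ℤ) + k = n) {ξ : π.smooth}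
    (hξ : (ξ : H) ∈ π.space n) : (π.modeOp k x ξ : H) ∈ π.space m :=
  π.mem_space_of_proj fun m' hm' => π.proj_modeOp (fun h => hm' (by omega)) hξ

theorem modeOp_eq_zero {k : ℤ} (x : 𝔤) {n : ℕ} (hk : (n : ℤ) < k) {ξ : π.smooth}
    (hξ : (ξ : H) ∈ π.space n) : π.modeOp k x ξ = 0 := by
  refine Subtype.ext (π.ext_proj fun m => ?_)
  rw [π.proj_modeOp (by omega) hξ, Submodule.coe_zero, map_zero]

/-! ### The energy bound for a single mode -/

/-- The modes of a fixed Hermitian `x` form a Heisenberg algebra. -/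
theorem inner_modeOp_modeOp {x : 𝔤} (hx : star x = x) (j k : ℤ) (ξ η : π.smooth) :
    ⟪π.modeOp (-k) x ξ, π.modeOp (-j) x η⟫_ℂ = ⟪π.modeOp j x ξ, π.modeOp k x η⟫_ℂ
      + (if k = j then (π.level * k * basicForm 𝔥 x x : ℂ) else 0) * ⟪ξ, η⟫_ℂ := by
  have h1 := π.inner_modeOp k x ξ (π.modeOp (-j) x η)
  have h2 := π.inner_modeOp (-j) x ξ (π.modeOp k x η)
  rw [hx] at h1 h2
  rw [neg_neg] at h2
  rw [← h1, ← h2, π.modeOp_commutator, lie_self, map_zero, LinearMap.zero_apply, add_zero,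
    inner_add_right, inner_smul_right]
  simp only [← sub_eq_add_neg, sub_eq_zero]

theorem norm_modeOp_neg_sq {x : 𝔤} (hx : star x = x) (k : ℤ) (ξ : π.smooth) :
    ‖π.modeOp (-k) x ξ‖ ^ 2 = ‖π.modeOp k x ξ‖ ^ 2
      + π.level * k * (basicForm 𝔥 x x).re * ‖ξ‖ ^ 2 := by
  have h := congrArg Complex.re (π.inner_modeOp_modeOp hx k k ξ ξ)
  rw [inner_self_eq_norm_sq_to_K, inner_self_eq_norm_sq_to_K, inner_self_eq_norm_sq_to_K,
    if_pos rfl] at h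
  simpa [← Complex.ofReal_pow, ← Complex.ofReal_intCast, ← Complex.ofReal_mul] using h

/-- The number-operator estimate `∑_{1 ≤ k ≤ K} x(k)* x(k) ≤ c d` for Hermitian `x`, by induction
on the energy. With `v = ∑ x(k)* x(k) ξ` and `S = ∑ ‖x(k) ξ‖² = ⟨ξ, v⟩`, the Heisenberg relations
and the induction hypothesis give `‖v‖² ≤ c n S`, and then `S² ≤ ‖ξ‖² ‖v‖²`. -/
theorem sum_norm_modeOp_sq_le {x : 𝔤} (hx : star x = x) {c : ℝ}
    (hc : |π.level * (basicForm 𝔥 x x).re| ≤ c) (K n : ℕ) (ξ : π.smooth)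
    (hξ : (ξ : H) ∈ π.space n) :
    ∑ k ∈ Finset.Icc 1 K, ‖π.modeOp k x ξ‖ ^ 2 ≤ c * n * ‖ξ‖ ^ 2 := by
  induction n using Nat.strong_induction_on generalizing ξ with
  | _ n ih =>
    have hc0 : 0 ≤ c := (abs_nonneg _).trans hc
    set S := ∑ k ∈ Finset.Icc 1 K, ‖π.modeOp k x ξ‖ ^ 2 with hS
    set v : π.smooth := ∑ k ∈ Finset.Icc 1 K, π.modeOp (-k) x (π.modeOp k x ξ) with hv
    have hS0 : 0 ≤ S := Finset.sum_nonneg fun k _ => sq_nonneg _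
    have hSv : (S : ℂ) = ⟪ξ, v⟫_ℂ := by
      rw [hv, inner_sum, hS]
      push_cast
      refine Finset.sum_congr rfl fun k _ => ?_
      have h1 := π.inner_modeOp (-k) x ξ (π.modeOp k x ξ)
      rw [hx, neg_neg] at h1
      rw [h1, inner_self_eq_norm_sq_to_K]
      rfl
    have hcomm : ∀ j ∈ Finset.Icc 1 K, ∀ k ∈ Finset.Icc 1 K,
        π.modeOp k x (π.modeOp j x ξ) = π.modeOp j x (π.modeOp k x ξ) := fun j hj k hk => by
      have h1 := (Finset.mem_Icc.1 hj).1
      rw [π.modeOp_commutator, lie_self, map_zero, LinearMap.zero_apply, add_zero,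
        if_neg (by omega), zero_smul, add_zero]
    have hvv : ‖v‖ ^ 2 = ∑ k ∈ Finset.Icc 1 K,
        (∑ j ∈ Finset.Icc 1 K, ‖π.modeOp j x (π.modeOp k x ξ)‖ ^ 2
          + π.level * k * (basicForm 𝔥 x x).re * ‖π.modeOp k x ξ‖ ^ 2) := by
      have h1 : ((‖v‖ ^ 2 : ℝ) : ℂ) = ⟪v, v⟫_ℂ := by
        rw [inner_self_eq_norm_sq_to_K]
        push_cast
        rfl
      rw [← Complex.ofReal_re (‖v‖ ^ 2), h1, hv, sum_inner, Complex.re_sum]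
      refine Finset.sum_congr rfl fun k hk => ?_
      rw [inner_sum, Complex.re_sum]
      have h2 : ∀ j ∈ Finset.Icc 1 K,
          (⟪π.modeOp (-k) x (π.modeOp k x ξ), π.modeOp (-j) x (π.modeOp j x ξ)⟫_ℂ).re
          = ‖π.modeOp j x (π.modeOp k x ξ)‖ ^ 2 + if k = j then
            π.level * k * (basicForm 𝔥 x x).re * ‖π.modeOp k x ξ‖ ^ 2 else 0 := fun j hj => by
        rw [π.inner_modeOp_modeOp hx, hcomm j hj k hk, inner_self_eq_norm_sq_to_K]
        by_cases hkj : k = j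
        · subst hkj
          rw [if_pos rfl, if_pos rfl, inner_self_eq_norm_sq_to_K]
          simp [← Complex.ofReal_pow, ← Complex.ofReal_mul, ← Complex.ofReal_natCast]
        · rw [if_neg (by exact_mod_cast hkj), if_neg hkj]
          simp [← Complex.ofReal_pow]
      rw [Finset.sum_congr rfl h2, Finset.sum_add_distrib, Finset.sum_ite_eq, if_pos hk]
    have hvS : ‖v‖ ^ 2 ≤ c * n * S := by
      rw [hvv, hS, Finset.mul_sum]
      refine Finset.sum_le_sum fun k hk => ?_
      rcases lt_or_ge n k with hkn | hkn
      · rw [π.modeOp_eq_zero x (by exact_mod_cast hkn) hξ]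
        simp
      · have hk1 := (Finset.mem_Icc.1 hk).1
        have h1 := ih (n - k) (by omega) (π.modeOp k x ξ) (π.modeOp_mem x (by omega) hξ)
        have h2 : π.level * k * (basicForm 𝔥 x x).re * ‖π.modeOp k x ξ‖ ^ 2
            ≤ c * k * ‖π.modeOp k x ξ‖ ^ 2 := by
          refine mul_le_mul_of_nonneg_right ?_ (sq_nonneg _)
          have h3 := mul_le_mul_of_nonneg_right ((le_abs_self _).trans hc) k.cast_nonneg (α := ℝ)
          linarith
        rw [Nat.cast_sub hkn] at h1
        linarith
    have hSn : S ≤ ‖ξ‖ * ‖v‖ := by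
      have h1 := norm_inner_le_norm (𝕜 := ℂ) ξ v
      rwa [← hSv, Complex.norm_real, Real.norm_of_nonneg hS0] at h1
    have h2 : S * S ≤ (c * n * ‖ξ‖ ^ 2) * S :=
      calc S * S ≤ (‖ξ‖ * ‖v‖) * (‖ξ‖ * ‖v‖) := mul_le_mul hSn hSn hS0 (by positivity)
        _ = ‖ξ‖ ^ 2 * ‖v‖ ^ 2 := by ring
        _ ≤ ‖ξ‖ ^ 2 * (c * n * S) := by gcongr
        _ = (c * n * ‖ξ‖ ^ 2) * S := by ring
    rcases hS0.eq_or_lt with h0 | h0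
    · rw [← h0]
      positivity
    · exact le_of_mul_le_mul_right h2 h0

end PositiveEnergyRep

section LieAlgebraFacts

variable {𝔤 : Type*} [NormedLieRing 𝔤] [NormedLieAlgebra 𝔤]

/-- The derived ideal of a simple Lie algebra is not zero, hence everything. -/
theorem span_lie_eq_top [LieAlgebra.IsSimple ℂ 𝔤] :
    Submodule.span ℂ {z : 𝔤 | ∃ x y : 𝔤, ⁅x, y⁆ = z} = ⊤ := by
  have h : (⁅(⊤ : LieIdeal ℂ 𝔤), (⊤ : LieIdeal ℂ 𝔤)⁆ : LieIdeal ℂ 𝔤) = ⊤ := by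
    refine (LieAlgebra.IsSimple.eq_bot_or_eq_top (R := ℂ) _).resolve_left fun h => ?_
    refine LieAlgebra.IsSimple.non_abelian ℂ (L := 𝔤) ⟨fun x y => ?_⟩
    have h1 := LieSubmodule.lie_mem_lie (LieSubmodule.mem_top (R := ℂ) (L := 𝔤) x)
      (LieSubmodule.mem_top (R := ℂ) (L := 𝔤) y)
    rw [h] at h1
    simpa using h1
  have h2 := LieSubmodule.lieIdeal_oper_eq_linear_span' (⊤ : LieIdeal ℂ 𝔤) (⊤ : LieIdeal ℂ 𝔤)
  rw [h] at h2
  simpa [eq_comm] using h2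

theorem exists_hermitian_decomposition [StarAddMonoid 𝔤] [StarModule ℂ 𝔤] [NormedStarGroup 𝔤]
    (x : 𝔤) : ∃ a b : 𝔤, star a = a ∧ star b = b ∧ ‖a‖ ≤ ‖x‖ ∧ ‖b‖ ≤ ‖x‖ ∧
      x = a + Complex.I • b := by
  refine ⟨(1 / 2 : ℂ) • (x + star x), (-Complex.I / 2) • (x - star x), ?_, ?_, ?_, ?_, ?_⟩
  · rw [star_smul, star_add, star_star, add_comm]
    congr 1
    simp
  · rw [star_smul, star_sub, star_star, ← neg_sub x, smul_neg, ← neg_smul]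
    congr 1
    simp
    ring
  · rw [norm_smul]
    have := norm_add_le x (star x)
    rw [norm_star] at this
    norm_num
    linarith
  · rw [norm_smul]
    have := norm_sub_le x (star x)
    rw [norm_star] at this
    norm_num
    linarith
  · rw [smul_smul, mul_div_assoc', mul_neg, Complex.I_mul_I]
    module

end LieAlgebraFacts

namespace PositiveEnergyRep

variable {𝔤 : Type*} [NormedLieRing 𝔤] [NormedLieAlgebra 𝔤]
    [FiniteDimensional ℂ 𝔤] [LieAlgebra.IsSimple ℂ 𝔤]
    [StarAddMonoid 𝔤] [StarModule ℂ 𝔤] [NormedStarGroup 𝔤]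
    {𝔥 : LieSubalgebra ℂ 𝔤} [𝔥.IsCartanSubalgebra]
    {H : Type*} [NormedAddCommGroup H] [InnerProductSpace ℂ H] [CompleteSpace H]
    (π : PositiveEnergyRep 𝔤 𝔥 H)

theorem exists_level_bound :
    ∃ C : ℝ, 0 ≤ C ∧ ∀ x : 𝔤, |π.level * (basicForm 𝔥 x x).re| ≤ C * ‖x‖ ^ 2 := by
  set B := (basicForm 𝔥).toContinuousBilinearMap
  refine ⟨|π.level| * ‖B‖, by positivity, fun x => ?_⟩
  have h1 : |(basicForm 𝔥 x x).re| ≤ ‖B‖ * ‖x‖ * ‖x‖ :=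
    (Complex.abs_re_le_norm _).trans (B.le_opNorm₂ x x)
  rw [abs_mul]
  calc |π.level| * |(basicForm 𝔥 x x).re| ≤ |π.level| * (‖B‖ * ‖x‖ * ‖x‖) := by gcongr
    _ = _ := by ring

theorem norm_modeOp_sq_le_of_add {a b x : 𝔤} (h : x = a + Complex.I • b) (k : ℤ) (ξ : π.smooth) :
    ‖π.modeOp k x ξ‖ ^ 2 ≤ 2 * ‖π.modeOp k a ξ‖ ^ 2 + 2 * ‖π.modeOp k b ξ‖ ^ 2 := by
  have h1 := norm_add_le (π.modeOp k a ξ) (Complex.I • π.modeOp k b ξ)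
  rw [norm_smul, Complex.norm_I, one_mul] at h1
  rw [h, map_add, map_smul, LinearMap.add_apply, LinearMap.smul_apply]
  nlinarith [sq_nonneg (‖π.modeOp k a ξ‖ - ‖π.modeOp k b ξ‖),
    norm_nonneg (π.modeOp k a ξ + Complex.I • π.modeOp k b ξ)]

theorem exists_nonzero_mode_bounds : ∃ C : ℝ, 0 ≤ C ∧ ∀ (x : 𝔤) (n : ℕ) (ξ : π.smooth),
    (ξ : H) ∈ π.space n →
      (∀ K : ℕ, ∑ k ∈ Finset.Icc 1 K, ‖π.modeOp k x ξ‖ ^ 2 ≤ C * ‖x‖ ^ 2 * n * ‖ξ‖ ^ 2) ∧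
      (∀ K : ℕ, ∑ k ∈ Finset.Icc 1 K, ‖π.modeOp (-k) x ξ‖ ^ 2
        ≤ C * ‖x‖ ^ 2 * (n + K ^ 2) * ‖ξ‖ ^ 2) ∧
      (∀ k : ℕ, 1 ≤ k → ‖π.modeOp (-k) x ξ‖ ^ 2 ≤ C * ‖x‖ ^ 2 * (n + k) * ‖ξ‖ ^ 2) := by
  obtain ⟨C, hC0, hC⟩ := π.exists_level_bound
  refine ⟨4 * C, by positivity, fun x n ξ hξ => ?_⟩
  have pos : ∀ a : 𝔤, star a = a → ‖a‖ ≤ ‖x‖ → ∀ K : ℕ,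
      ∑ k ∈ Finset.Icc 1 K, ‖π.modeOp k a ξ‖ ^ 2 ≤ C * ‖x‖ ^ 2 * n * ‖ξ‖ ^ 2 :=
    fun a ha hax K => π.sum_norm_modeOp_sq_le ha ((hC a).trans (by gcongr)) K n ξ hξ
  have neg1 : ∀ a : 𝔤, star a = a → ‖a‖ ≤ ‖x‖ → ∀ k : ℕ,
      ‖π.modeOp (-k) a ξ‖ ^ 2 ≤ ‖π.modeOp k a ξ‖ ^ 2 + C * ‖x‖ ^ 2 * k * ‖ξ‖ ^ 2 := by
    intro a ha hax k
    rw [π.norm_modeOp_neg_sq ha]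
    have h1 : π.level * (basicForm 𝔥 a a).re ≤ C * ‖x‖ ^ 2 :=
      (le_abs_self _).trans ((hC a).trans (by gcongr))
    have h2 := mul_le_mul_of_nonneg_right h1 (by positivity : 0 ≤ (k : ℝ) * ‖ξ‖ ^ 2)
    push_cast
    linarith
  have single : ∀ a : 𝔤, star a = a → ‖a‖ ≤ ‖x‖ → ∀ k : ℕ, 1 ≤ k →
      ‖π.modeOp (-k) a ξ‖ ^ 2 ≤ C * ‖x‖ ^ 2 * (n + k) * ‖ξ‖ ^ 2 := by
    intro a ha hax k hk
    have h1 := Finset.single_le_sum (f := fun k : ℕ => ‖π.modeOp k a ξ‖ ^ 2)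
      (fun _ _ => sq_nonneg _) (Finset.mem_Icc.2 ⟨hk, le_rfl⟩)
    have h2 := neg1 a ha hax k
    have h3 := pos a ha hax k
    linarith
  have neg : ∀ a : 𝔤, star a = a → ‖a‖ ≤ ‖x‖ → ∀ K : ℕ,
      ∑ k ∈ Finset.Icc 1 K, ‖π.modeOp (-k) a ξ‖ ^ 2
        ≤ C * ‖x‖ ^ 2 * (n + K ^ 2) * ‖ξ‖ ^ 2 := by
    intro a ha hax K
    have h1 := Finset.sum_le_sum fun k (_ : k ∈ Finset.Icc 1 K) => neg1 a ha hax k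
    rw [Finset.sum_add_distrib] at h1
    have h2 : ∑ k ∈ Finset.Icc 1 K, C * ‖x‖ ^ 2 * k * ‖ξ‖ ^ 2
        ≤ ∑ _k ∈ Finset.Icc 1 K, C * ‖x‖ ^ 2 * K * ‖ξ‖ ^ 2 :=
      Finset.sum_le_sum fun k hk => by
        have : (k : ℝ) ≤ K := by exact_mod_cast (Finset.mem_Icc.1 hk).2
        gcongr
    rw [Finset.sum_const, Nat.card_Icc, Nat.add_sub_cancel, nsmul_eq_mul] at h2
    have h3 := pos a ha hax K
    nlinarith
  obtain ⟨a, b, ha, hb, hax, hbx, hx⟩ := exists_hermitian_decomposition x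
  refine ⟨fun K => ?_, fun K => ?_, fun k hk => ?_⟩
  · have h1 := Finset.sum_le_sum fun k (_ : k ∈ Finset.Icc 1 K) =>
      π.norm_modeOp_sq_le_of_add hx k ξ
    rw [Finset.sum_add_distrib, ← Finset.mul_sum, ← Finset.mul_sum] at h1
    linarith [pos a ha hax K, pos b hb hbx K]
  · have h1 := Finset.sum_le_sum fun k (_ : k ∈ Finset.Icc 1 K) =>
      π.norm_modeOp_sq_le_of_add hx (-k) ξ
    rw [Finset.sum_add_distrib, ← Finset.mul_sum, ← Finset.mul_sum] at h1
    linarith [neg a ha hax K, neg b hb hbx K]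
  · linarith [π.norm_modeOp_sq_le_of_add hx (-k) ξ, single a ha hax k hk, single b hb hbx k hk]

/-- The zero mode of a bracket. Averaging `[y,z](0) = [y(k), z(-k)] - ℓ k ⟨y, z⟩` over
`1 ≤ k ≤ K` and using the bounds on sums over modes gives a bound `O(K)` on `H(n)` as soon
as `n ≤ K²`. -/
theorem exists_zero_mode_bound_lie (y z : 𝔤) : ∃ D : ℝ, 0 ≤ D ∧ ∀ (n : ℕ) (ξ : π.smooth),
    (ξ : H) ∈ π.space n → ‖π.modeOp 0 ⁅y, z⁆ ξ‖ ≤ D * √(1 + n) * ‖ξ‖ := by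
  obtain ⟨C, hC0, hC⟩ := π.exists_nonzero_mode_bounds
  set b := ‖(π.level * basicForm 𝔥 y z : ℂ)‖ with hb
  refine ⟨(4 * C * ‖y‖ * ‖z‖ + b) * √2, by positivity, fun n ξ hξ => ?_⟩
  set v := π.modeOp 0 ⁅y, z⁆ ξ with hv
  have hvn : (v : H) ∈ π.space n := π.modeOp_mem _ (by simp) hξ
  -- the smallest natural number with `n < K²`, which balances the bounds `O((n + K²) / K)`
  set K := Nat.sqrt n + 1 with hK
  have hnK : (n : ℝ) ≤ (K : ℝ) ^ 2 := by
    have := (Nat.lt_succ_sqrt n).le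
    rw [pow_two]
    exact_mod_cast this
  have hKn : (K : ℝ) ≤ √2 * √(1 + n) := by
    rw [← Real.sqrt_mul (by norm_num)]
    refine Real.le_sqrt_of_sq_le ?_
    have h1 : (Nat.sqrt n : ℝ) * Nat.sqrt n ≤ n := by exact_mod_cast Nat.sqrt_le n
    rw [hK]
    push_cast
    nlinarith [sq_nonneg ((Nat.sqrt n : ℝ) - 1)]
  have hK0 : (0 : ℝ) < K := by positivity
  have cs : ∀ (s t : ℝ) (f g : ℕ → ℝ), 0 ≤ s → 0 ≤ t →
      ∑ k ∈ Finset.Icc 1 K, f k ^ 2 ≤ 2 * C * K ^ 2 * s ^ 2 →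
      ∑ k ∈ Finset.Icc 1 K, g k ^ 2 ≤ 2 * C * K ^ 2 * t ^ 2 →
      ∑ k ∈ Finset.Icc 1 K, f k * g k ≤ 2 * C * K ^ 2 * (s * t) := by
    intro s t f g hs ht hf hg
    refine (Real.sum_mul_le_sqrt_mul_sqrt _ f g).trans ?_
    refine (mul_le_mul (Real.sqrt_le_sqrt hf) (Real.sqrt_le_sqrt hg) (Real.sqrt_nonneg _)
      (Real.sqrt_nonneg _)).trans (le_of_eq ?_)
    rw [← Real.sqrt_mul (by positivity), show 2 * C * (K : ℝ) ^ 2 * s ^ 2 * (2 * C * K ^ 2 * t ^ 2)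
      = (2 * C * K ^ 2 * (s * t)) ^ 2 by ring, Real.sqrt_sq (by positivity)]
  have est : ∀ (x : 𝔤) (η : π.smooth), (η : H) ∈ π.space n →
      ∑ k ∈ Finset.Icc 1 K, ‖π.modeOp k x η‖ ^ 2 ≤ 2 * C * K ^ 2 * (‖x‖ * ‖η‖) ^ 2 ∧
      ∑ k ∈ Finset.Icc 1 K, ‖π.modeOp (-k) x η‖ ^ 2 ≤ 2 * C * K ^ 2 * (‖x‖ * ‖η‖) ^ 2 := by
    intro x η hη
    obtain ⟨h1, h2, -⟩ := hC x n η hη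
    have e : 2 * C * K ^ 2 * (‖x‖ * ‖η‖) ^ 2 = C * ‖x‖ ^ 2 * (K ^ 2 + K ^ 2) * ‖η‖ ^ 2 := by ring
    rw [e]
    refine ⟨(h1 K).trans ?_, (h2 K).trans ?_⟩
    · gcongr
      linarith [sq_nonneg (K : ℝ)]
    · gcongr
  have key : ∀ k ∈ Finset.Icc 1 K, ‖v‖ ^ 2 ≤
      ‖π.modeOp (-k) (star y) v‖ * ‖π.modeOp (-k) z ξ‖
        + ‖π.modeOp k (star z) v‖ * ‖π.modeOp k y ξ‖ + b * K * (‖v‖ * ‖ξ‖) := by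
    intro k hk
    have h1 := π.modeOp_commutator k (-k) y z ξ
    rw [add_neg_cancel, if_pos rfl, ← hv] at h1
    have h2 : v = π.modeOp k y (π.modeOp (-k) z ξ) - π.modeOp (-k) z (π.modeOp k y ξ)
        - (π.level * (k : ℤ) * basicForm 𝔥 y z : ℂ) • ξ := by
      rw [h1]
      abel
    have h3 : ⟪v, v⟫_ℂ = ⟪π.modeOp (-k) (star y) v, π.modeOp (-k) z ξ⟫_ℂ
        - ⟪π.modeOp k (star z) v, π.modeOp k y ξ⟫_ℂ
        - (π.level * (k : ℤ) * basicForm 𝔥 y z : ℂ) * ⟪v, ξ⟫_ℂ := by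
      refine (congrArg (fun u => ⟪v, u⟫_ℂ) h2).trans ?_
      rw [inner_sub_right, inner_sub_right, inner_smul_right, π.inner_modeOp k y v,
        π.inner_modeOp (-k) z v, neg_neg]
    have h4 : ‖v‖ ^ 2 = ‖⟪v, v⟫_ℂ‖ := by
      rw [inner_self_eq_norm_sq_to_K]
      simp
    have hkK : (k : ℝ) ≤ K := by exact_mod_cast (Finset.mem_Icc.1 hk).2
    rw [h4, h3]
    refine (norm_sub_le _ _).trans (add_le_add ((norm_sub_le _ _).trans (add_le_add
      (norm_inner_le_norm _ _) (norm_inner_le_norm _ _))) ?_)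
    rw [norm_mul]
    have h5 : ‖(π.level * (k : ℤ) * basicForm 𝔥 y z : ℂ)‖ = b * k := by
      rw [hb, mul_right_comm, norm_mul]
      simp
    rw [h5]
    gcongr
    exact norm_inner_le_norm _ _
  have hsum := Finset.sum_le_sum key
  rw [Finset.sum_const, Nat.card_Icc, Nat.add_sub_cancel, nsmul_eq_mul, Finset.sum_add_distrib,
    Finset.sum_add_distrib, Finset.sum_const, Nat.card_Icc, Nat.add_sub_cancel,
    nsmul_eq_mul] at hsum
  have c1 := cs _ _ _ _ (by positivity) (by positivity) (est (star y) v hvn).2 (est z ξ hξ).2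
  have c2 := cs _ _ _ _ (by positivity) (by positivity) (est (star z) v hvn).1 (est y ξ hξ).1
  rw [norm_star] at c1 c2
  have h6 : (K * ‖v‖) * ‖v‖ ≤ (K * ((4 * C * ‖y‖ * ‖z‖ + b) * K * ‖ξ‖)) * ‖v‖ := by
    linarith
  rcases (norm_nonneg v).eq_or_lt with h0 | h0
  · rw [← h0]
    positivity
  · have h7 := le_of_mul_le_mul_left (le_of_mul_le_mul_right h6 h0) hK0
    calc ‖v‖ ≤ (4 * C * ‖y‖ * ‖z‖ + b) * K * ‖ξ‖ := h7
      _ ≤ (4 * C * ‖y‖ * ‖z‖ + b) * (√2 * √(1 + n)) * ‖ξ‖ := by gcongr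
      _ = _ := by ring

theorem exists_zero_mode_bound (x : 𝔤) : ∃ D : ℝ, 0 ≤ D ∧ ∀ (n : ℕ) (ξ : π.smooth),
    (ξ : H) ∈ π.space n → ‖π.modeOp 0 x ξ‖ ≤ D * √(1 + n) * ‖ξ‖ := by
  have hx : x ∈ Submodule.span ℂ {z : 𝔤 | ∃ x y : 𝔤, ⁅x, y⁆ = z} := by
    rw [span_lie_eq_top]
    trivial
  induction hx using Submodule.span_induction with
  | mem x h =>
    obtain ⟨y, z, rfl⟩ := h
    exact π.exists_zero_mode_bound_lie y z
  | zero => exact ⟨0, le_rfl, fun n ξ _ => by simp⟩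
  | add x y _ _ hx hy =>
    obtain ⟨D, hD0, hD⟩ := hx
    obtain ⟨D', hD0', hD'⟩ := hy
    refine ⟨D + D', by positivity, fun n ξ hξ => ?_⟩
    rw [map_add, LinearMap.add_apply]
    refine (norm_add_le _ _).trans ?_
    linarith [hD n ξ hξ, hD' n ξ hξ]
  | smul c x _ hx =>
    obtain ⟨D, hD0, hD⟩ := hx
    refine ⟨‖c‖ * D, by positivity, fun n ξ hξ => ?_⟩
    rw [map_smul, LinearMap.smul_apply, norm_smul, mul_assoc, mul_assoc, ← mul_assoc D]
    gcongr
    exact hD n ξ hξ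

theorem exists_zero_mode_bound_uniform : ∃ C : ℝ, 0 ≤ C ∧ ∀ (x : 𝔤) (n : ℕ) (ξ : π.smooth),
    (ξ : H) ∈ π.space n → ‖π.modeOp 0 x ξ‖ ≤ C * ‖x‖ * √(1 + n) * ‖ξ‖ := by
  set b := Module.finBasis ℂ 𝔤
  choose D hD0 hD using fun i => π.exists_zero_mode_bound (b i)
  set φ := fun i => LinearMap.toContinuousLinearMap (b.coord i)
  refine ⟨∑ i, ‖φ i‖ * D i, Finset.sum_nonneg fun i _ => mul_nonneg (norm_nonneg _) (hD0 i),
    fun x n ξ hξ => ?_⟩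
  conv_lhs => rw [← b.sum_repr x]
  rw [map_sum, LinearMap.sum_apply, Finset.sum_mul, Finset.sum_mul, Finset.sum_mul]
  refine norm_sum_le_of_le _ fun i _ => ?_
  rw [map_smul, LinearMap.smul_apply, norm_smul]
  have h1 : ‖b.repr x i‖ ≤ ‖φ i‖ * ‖x‖ := (φ i).le_opNorm x
  calc ‖b.repr x i‖ * ‖π.modeOp 0 (b i) ξ‖ ≤ (‖φ i‖ * ‖x‖) * (D i * √(1 + n) * ‖ξ‖) := by
        gcongr
        exact hD i n ξ hξ
    _ = _ := by ring

/-- The energy bound for single modes: `x(k)` is `O(‖x‖ (1 + max(n, m))^{1/2})` from `H(n)`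
to `H(m)`. -/
theorem exists_mode_bound : ∃ C : ℝ, 0 ≤ C ∧ ∀ (k : ℤ) (x : 𝔤) (n m : ℕ) (ξ : π.smooth),
    (m : ℤ) + k = n → (ξ : H) ∈ π.space n →
      ‖π.modeOp k x ξ‖ ≤ C * ‖x‖ * √(1 + (max n m : ℕ)) * ‖ξ‖ := by
  obtain ⟨C, hC0, hC⟩ := π.exists_nonzero_mode_bounds
  obtain ⟨D, hD0, hD⟩ := π.exists_zero_mode_bound_uniform
  refine ⟨√C + D, by positivity, fun k x n m ξ hmn hξ => ?_⟩
  have hD' : 0 ≤ D * ‖x‖ * √(1 + (max n m : ℕ)) * ‖ξ‖ := by positivity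
  have hC' : 0 ≤ √C * ‖x‖ * √(1 + (max n m : ℕ)) * ‖ξ‖ := by positivity
  have e : (√C + D) * ‖x‖ * √(1 + (max n m : ℕ)) * ‖ξ‖ = √C * ‖x‖ * √(1 + (max n m : ℕ)) * ‖ξ‖
    + D * ‖x‖ * √(1 + (max n m : ℕ)) * ‖ξ‖ := by ring
  have hsq : (√C * ‖x‖ * √(1 + (max n m : ℕ)) * ‖ξ‖) ^ 2
      = C * ‖x‖ ^ 2 * (1 + (max n m : ℕ)) * ‖ξ‖ ^ 2 := by
    rw [mul_pow, mul_pow, mul_pow, Real.sq_sqrt hC0, Real.sq_sqrt (by positivity)]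
  rw [e]
  obtain ⟨h1, -, h3⟩ := hC x n ξ hξ
  rcases lt_trichotomy k 0 with hk | hk | hk
  · obtain ⟨j, rfl⟩ : ∃ j : ℕ, k = -j := ⟨k.natAbs, by omega⟩
    refine le_add_of_le_of_nonneg (le_of_sq_le_sq ?_ hC') hD'
    rw [hsq]
    refine (h3 j (by omega)).trans ?_
    have : (n : ℝ) + j ≤ 1 + (max n m : ℕ) := by
      have : n + j ≤ 1 + max n m := by omega
      exact_mod_cast this
    gcongr
  · subst hk
    refine le_add_of_nonneg_of_le hC' ((hD x n ξ hξ).trans ?_)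
    have : n ≤ max n m := le_max_left _ _
    gcongr
  · obtain ⟨j, rfl⟩ : ∃ j : ℕ, k = j := ⟨k.natAbs, by omega⟩
    refine le_add_of_le_of_nonneg (le_of_sq_le_sq ?_ hC') hD'
    rw [hsq]
    have h4 := Finset.single_le_sum (f := fun k : ℕ => ‖π.modeOp k x ξ‖ ^ 2)
      (fun _ _ => sq_nonneg _) (Finset.mem_Icc.2 ⟨by omega, le_rfl⟩ : j ∈ Finset.Icc 1 j)
    refine h4.trans ((h1 j).trans ?_)
    have : (n : ℝ) ≤ 1 + (max n m : ℕ) := by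
      have : n ≤ 1 + max n m := by omega
      exact_mod_cast this
    gcongr

end PositiveEnergyRep

/-! ### Extension to Sobolev loops -/

section SobolevSums

theorem weight_three_half (k : ℤ) : (1 + |(k : ℝ)|) ^ (2 * (3 / 2 : ℝ)) = (1 + |(k : ℝ)|) ^ 3 := by
  rw [← Real.rpow_natCast]
  norm_num

theorem summable_inv_sq_int : Summable fun k : ℤ => ((1 + |(k : ℝ)|) ^ 2)⁻¹ := by
  have hs : Summable fun k : ℤ => |(k : ℝ)| ^ (-2 : ℝ) :=
    Real.summable_abs_int_rpow (by norm_num)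
  refine Summable.of_norm_bounded_eventually hs ?_
  have hfin : ({0} : Set ℤ).Finite := Set.finite_singleton 0
  filter_upwards [hfin.compl_mem_cofinite] with k hk
  have hk0 : k ≠ 0 := by simpa using hk
  have hk1 : (1 : ℝ) ≤ |(k : ℝ)| := by exact_mod_cast Int.one_le_abs hk0
  have e2 : |(k : ℝ)| ^ (-2 : ℝ) = (|(k : ℝ)| ^ 2)⁻¹ := by
    rw [Real.rpow_neg (abs_nonneg _)]
    norm_num
  rw [Real.norm_of_nonneg (by positivity), e2]
  have : 0 < |(k : ℝ)| := by linarith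
  gcongr
  linarith

variable {𝔤 : Type*} [NormedLieRing 𝔤] [NormedLieAlgebra 𝔤]

theorem sum_sqrt_mul_fourierCoeff_le (X : sobolevLoops 𝔤 (3 / 2)) (s : Finset ℤ) :
    ∑ k ∈ s, √(1 + |(k : ℝ)|) * ‖fourierCoeff X.1 k‖
      ≤ √(∑' k : ℤ, ((1 + |(k : ℝ)|) ^ 2)⁻¹) * sobolevLoops.norm X := by
  have hX : Summable fun k : ℤ =>
    (1 + |(k : ℝ)|) ^ (2 * (3 / 2 : ℝ)) * ‖fourierCoeff X.1 k‖ ^ 2 := X.2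
  have h1 : ∀ k : ℤ, √(1 + |(k : ℝ)|) * ‖fourierCoeff X.1 k‖
      = (1 + |(k : ℝ)|)⁻¹ * ((1 + |(k : ℝ)|) * √(1 + |(k : ℝ)|) * ‖fourierCoeff X.1 k‖) := by
    intro k
    have : 1 + |(k : ℝ)| ≠ 0 := by positivity
    field_simp
  simp only [h1]
  refine (Real.sum_mul_le_sqrt_mul_sqrt _ _ _).trans ?_
  refine mul_le_mul (Real.sqrt_le_sqrt ?_) (Real.sqrt_le_sqrt ?_) (Real.sqrt_nonneg _)
    (Real.sqrt_nonneg _)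
  · simp only [inv_pow]
    exact summable_inv_sq_int.sum_le_tsum s fun k _ => by positivity
  · refine le_trans (le_of_eq (Finset.sum_congr rfl fun k _ => ?_))
      (hX.sum_le_tsum s fun k _ => by positivity)
    rw [weight_three_half, mul_pow, mul_pow, Real.sq_sqrt (by positivity)]
    ring

theorem summable_sqrt_mul_fourierCoeff (X : sobolevLoops 𝔤 (3 / 2)) :
    Summable fun k : ℤ => √(1 + |(k : ℝ)|) * ‖fourierCoeff X.1 k‖ :=
  summable_of_sum_le (fun k => by positivity) (sum_sqrt_mul_fourierCoeff_le X)

theorem tsum_sqrt_mul_fourierCoeff_le (X : sobolevLoops 𝔤 (3 / 2)) :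
    ∑' k : ℤ, √(1 + |(k : ℝ)|) * ‖fourierCoeff X.1 k‖
      ≤ √(∑' k : ℤ, ((1 + |(k : ℝ)|) ^ 2)⁻¹) * sobolevLoops.norm X :=
  Summable.tsum_le_of_sum_le (summable_sqrt_mul_fourierCoeff X) (sum_sqrt_mul_fourierCoeff_le X)

section Conj

variable [FiniteDimensional ℂ 𝔤] [StarAddMonoid 𝔤] [StarModule ℂ 𝔤] [NormedStarGroup 𝔤]

theorem sobolevLoops.fourierCoeff_conj (X : sobolevLoops 𝔤 (3 / 2)) (k : ℤ) :
    fourierCoeff (sobolevLoops.conj X).1 k = star (fourierCoeff X.1 (-k)) :=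
  fourierCoeff_Lp_star X.1 k

theorem sobolevLoops.conj_conj (X : sobolevLoops 𝔤 (3 / 2)) :
    sobolevLoops.conj (sobolevLoops.conj X) = X := Subtype.ext (star_star X.1)

end Conj

end SobolevSums

namespace PositiveEnergyRep

variable {𝔤 : Type*} [NormedLieRing 𝔤] [NormedLieAlgebra 𝔤]
    [FiniteDimensional ℂ 𝔤] [LieAlgebra.IsSimple ℂ 𝔤]
    [StarAddMonoid 𝔤] [StarModule ℂ 𝔤] [NormedStarGroup 𝔤]
    {𝔥 : LieSubalgebra ℂ 𝔤} [𝔥.IsCartanSubalgebra]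
    {H : Type*} [NormedAddCommGroup H] [InnerProductSpace ℂ H] [CompleteSpace H]
    (π : PositiveEnergyRep 𝔤 𝔥 H)

theorem inner_modeOp_eq_zero {k l : ℤ} (x y : 𝔤) {n m : ℕ} {ξ η : π.smooth}
    (hξ : (ξ : H) ∈ π.space n) (hη : (η : H) ∈ π.space m) (h : (n : ℤ) - k ≠ m - l) :
    ⟪(π.modeOp k x ξ : H), (π.modeOp l y η : H)⟫_ℂ = 0 := by
  rcases lt_or_ge (n : ℤ) k with hk | hk
  · rw [π.modeOp_eq_zero x hk hξ, Submodule.coe_zero, inner_zero_left]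
  rcases lt_or_ge (m : ℤ) l with hl | hl
  · rw [π.modeOp_eq_zero y hl hη, Submodule.coe_zero, inner_zero_right]
  obtain ⟨p, hp⟩ := Int.eq_ofNat_of_zero_le (sub_nonneg.2 hk)
  obtain ⟨q, hq⟩ := Int.eq_ofNat_of_zero_le (sub_nonneg.2 hl)
  exact π.inner_eq_zero (by omega) (π.modeOp_mem (m := p) x (by omega) hξ)
    (π.modeOp_mem (m := q) y (by omega) hη)

/-- The constant of the energy bound for single modes. -/
noncomputable def modeConst : ℝ := π.exists_mode_bound.choose

theorem modeConst_nonneg : 0 ≤ π.modeConst := π.exists_mode_bound.choose_spec.1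

theorem norm_modeOp_le {k : ℤ} (x : 𝔤) {n m : ℕ} {ξ : π.smooth} (hmn : (m : ℤ) + k = n)
    (hξ : (ξ : H) ∈ π.space n) :
    ‖(π.modeOp k x ξ : H)‖ ≤ π.modeConst * ‖x‖ * √(1 + (max n m : ℕ)) * ‖(ξ : H)‖ :=
  π.exists_mode_bound.choose_spec.2 k x n m ξ hmn hξ

theorem norm_modeOp_le_mul (k : ℤ) (x : 𝔤) {n : ℕ} {ξ : π.smooth} (hξ : (ξ : H) ∈ π.space n) :
    ‖(π.modeOp k x ξ : H)‖
      ≤ π.modeConst * ‖x‖ * √(1 + |(k : ℝ)|) * (√(1 + n) * ‖(ξ : H)‖) := by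
  have hC := π.modeConst_nonneg
  rcases lt_or_ge (n : ℤ) k with hk | hk
  · rw [π.modeOp_eq_zero x hk hξ, Submodule.coe_zero, norm_zero]
    positivity
  obtain ⟨m, hm⟩ := Int.eq_ofNat_of_zero_le (sub_nonneg.2 hk)
  refine (π.norm_modeOp_le x (m := m) (by omega) hξ).trans ?_
  have h1 : √(1 + (max n m : ℕ)) ≤ √(1 + |(k : ℝ)|) * √(1 + n) := by
    rw [← Real.sqrt_mul (by positivity)]
    refine Real.sqrt_le_sqrt ?_
    have h2 : ((max n m : ℕ) : ℝ) ≤ n + |(k : ℝ)| := by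
      have h3 : ((max n m : ℕ) : ℤ) ≤ n + |k| := by
        have := neg_abs_le k
        have := abs_nonneg k
        omega
      exact_mod_cast h3
    have h4 : 0 ≤ (n : ℝ) * |(k : ℝ)| := by positivity
    linarith
  calc π.modeConst * ‖x‖ * √(1 + (max n m : ℕ)) * ‖(ξ : H)‖
      ≤ π.modeConst * ‖x‖ * (√(1 + |(k : ℝ)|) * √(1 + n)) * ‖(ξ : H)‖ := by gcongr
    _ = _ := by ring

theorem exists_boundedMode (k : ℤ) (x : 𝔤) : ∃ T : H →L[ℂ] H,
    ‖T‖ ≤ π.modeConst * ‖x‖ * √(1 + |(k : ℝ)|) ∧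
    ∀ ξ, HasSum (fun n : ℕ => ((√(1 + n))⁻¹ : ℂ) • (π.modeOp k x (π.projSmooth n ξ) : H))
      (T ξ) := by
  have hC := π.modeConst_nonneg
  refine π.exists_sum_blocks (fun n => ((√(1 + n))⁻¹ : ℂ) •
    (π.smooth.subtype ∘ₗ π.modeOp k x ∘ₗ π.projSmooth n)) (by positivity) (fun n ξ => ?_)
    (fun ξ m n hmn => ?_)
  · have h1 := π.norm_modeOp_le_mul k x (n := n) (ξ := π.projSmooth n ξ) (π.proj_mem n ξ)
    rw [π.coe_projSmooth] at h1
    change ‖((√(1 + n))⁻¹ : ℂ) • (π.modeOp k x (π.projSmooth n ξ) : H)‖ ≤ _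
    have h0 : 0 < √(1 + (n : ℝ)) := by positivity
    rw [norm_smul, norm_inv, Complex.norm_real, Real.norm_of_nonneg h0.le, inv_mul_le_iff₀ h0]
    linarith
  · change ⟪((√(1 + m))⁻¹ : ℂ) • (π.modeOp k x (π.projSmooth m ξ) : H),
      ((√(1 + n))⁻¹ : ℂ) • (π.modeOp k x (π.projSmooth n ξ) : H)⟫_ℂ = 0
    rw [inner_smul_left, inner_smul_right, π.inner_modeOp_eq_zero x x (π.proj_mem m ξ)
      (π.proj_mem n ξ) (by omega), mul_zero, mul_zero]

/-- The bounded operator `x(k) (1 + d)^{-1/2}` on `H`. -/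
noncomputable def boundedMode (k : ℤ) : 𝔤 →ₗ[ℂ] H →L[ℂ] H where
  toFun x := (π.exists_boundedMode k x).choose
  map_add' x y := by
    ext ξ
    refine ((π.exists_boundedMode k (x + y)).choose_spec.2 ξ).unique ?_
    refine (((π.exists_boundedMode k x).choose_spec.2 ξ).add
      ((π.exists_boundedMode k y).choose_spec.2 ξ)).congr_fun fun n => ?_
    rw [map_add, LinearMap.add_apply, Submodule.coe_add, smul_add]
  map_smul' c x := by
    ext ξ
    refine ((π.exists_boundedMode k (c • x)).choose_spec.2 ξ).unique ?_
    refine (((π.exists_boundedMode k x).choose_spec.2 ξ).const_smul c).congr_fun fun n => ?_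
    rw [map_smul, LinearMap.smul_apply, Submodule.coe_smul, smul_comm]

theorem norm_boundedMode_le (k : ℤ) (x : 𝔤) :
    ‖π.boundedMode k x‖ ≤ π.modeConst * (√(1 + |(k : ℝ)|) * ‖x‖) :=
  (π.exists_boundedMode k x).choose_spec.1.trans (le_of_eq (by ring))

theorem hasSum_boundedMode (k : ℤ) (x : 𝔤) (ξ : π.sobolev (1 / 2)) :
    HasSum (fun n : ℕ => (π.modeOp k x (π.projSmooth n (ξ : H)) : H))
      (π.boundedMode k x (π.sqrtEnergy ξ)) := by
  refine ((π.exists_boundedMode k x).choose_spec.2 (π.sqrtEnergy ξ)).congr_fun fun n => ?_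
  have h1 : π.projSmooth n (π.sqrtEnergy ξ)
      = ((√(1 + (n : ℝ)) : ℝ) : ℂ) • π.projSmooth n (ξ : H) := Subtype.ext (π.proj_sqrtEnergy ξ n)
  have h2 : ((√(1 + (n : ℝ)) : ℝ) : ℂ) ≠ 0 :=
    Complex.ofReal_ne_zero.2 (Real.sqrt_pos.2 (by positivity)).ne'
  rw [h1, map_smul, Submodule.coe_smul, smul_smul, inv_mul_cancel₀ h2, one_smul]

theorem projSmooth_of_mem {n : ℕ} {ξ : π.smooth} (hξ : (ξ : H) ∈ π.space n) :
    π.projSmooth n (ξ : H) = ξ := Subtype.ext (π.proj_of_mem hξ)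

theorem projSmooth_of_mem_ne {m n : ℕ} (hmn : m ≠ n) {ξ : H} (hξ : ξ ∈ π.space n) :
    π.projSmooth m ξ = 0 := Subtype.ext (π.proj_of_mem_ne hmn hξ)

theorem boundedMode_of_mem (k : ℤ) (x : 𝔤) {n : ℕ} {ξ : π.smooth} (hξ : (ξ : H) ∈ π.space n)
    (h : (ξ : H) ∈ π.sobolev (1 / 2)) :
    π.boundedMode k x (π.sqrtEnergy ⟨ξ, h⟩) = (π.modeOp k x ξ : H) := by
  refine (π.hasSum_boundedMode k x ⟨ξ, h⟩).unique ?_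
  convert hasSum_single n fun m hm => ?_ using 1
  · rw [π.projSmooth_of_mem hξ]
  · rw [π.projSmooth_of_mem_ne hm hξ, map_zero, Submodule.coe_zero]

theorem summable_boundedMode (X : sobolevLoops 𝔤 (3 / 2)) :
    Summable fun k : ℤ => π.boundedMode k (fourierCoeff X.1 k) :=
  Summable.of_norm_bounded ((summable_sqrt_mul_fourierCoeff X).mul_left π.modeConst)
    fun k => π.norm_boundedMode_le k _

/-- The extension of `π` to `H^{3/2}(S¹, 𝔤)`: for `X = ∑ a_k e^{ikθ}`, the operator
`(∑ a_k(k) (1 + d)^{-1/2}) (1 + d)^{1/2}`, where the first sum converges in norm. -/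
noncomputable def sobolevOp : sobolevLoops 𝔤 (3 / 2) →ₗ[ℂ] (π.sobolev (1 / 2) →ₗ[ℂ] H) where
  toFun X := (∑' k : ℤ, π.boundedMode k (fourierCoeff X.1 k) : H →L[ℂ] H).toLinearMap
    ∘ₗ π.sqrtEnergy
  map_add' X Y := by
    have h : ∀ k, π.boundedMode k (fourierCoeff (X + Y).1 k)
        = π.boundedMode k (fourierCoeff X.1 k) + π.boundedMode k (fourierCoeff Y.1 k) := fun k => by
      rw [Submodule.coe_add, fourierCoeff_Lp_add, map_add]
    simp only [h]
    rw [(π.summable_boundedMode X).tsum_add (π.summable_boundedMode Y)]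
    rfl
  map_smul' c X := by
    have h : ∀ k, π.boundedMode k (fourierCoeff (c • X).1 k)
        = c • π.boundedMode k (fourierCoeff X.1 k) := fun k => by
      rw [Submodule.coe_smul, fourierCoeff_Lp_smul, map_smul]
    simp only [h]
    rw [(π.summable_boundedMode X).tsum_const_smul]
    rfl

theorem sobolevOp_apply (X : sobolevLoops 𝔤 (3 / 2)) (ξ : π.sobolev (1 / 2)) :
    π.sobolevOp X ξ
      = (∑' k : ℤ, π.boundedMode k (fourierCoeff X.1 k) : H →L[ℂ] H) (π.sqrtEnergy ξ) := rfl

theorem norm_sobolevOp_le (X : sobolevLoops 𝔤 (3 / 2)) (ξ : π.sobolev (1 / 2)) :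
    ‖π.sobolevOp X ξ‖ ≤ π.modeConst * √(∑' k : ℤ, ((1 + |(k : ℝ)|) ^ 2)⁻¹)
      * sobolevLoops.norm X * π.sobolevNorm (1 / 2) ξ := by
  rw [π.sobolevOp_apply, ← π.norm_sqrtEnergy]
  refine (ContinuousLinearMap.le_opNorm _ _).trans ?_
  refine mul_le_mul_of_nonneg_right ?_ (norm_nonneg _)
  have hs := (summable_sqrt_mul_fourierCoeff X).mul_left π.modeConst
  refine (tsum_of_norm_bounded hs.hasSum fun k => π.norm_boundedMode_le k _).trans ?_
  rw [tsum_mul_left, mul_assoc]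
  exact mul_le_mul_of_nonneg_left (tsum_sqrt_mul_fourierCoeff_le X) π.modeConst_nonneg

theorem hasSum_sobolevOp_modes (X : sobolevLoops 𝔤 (3 / 2)) (ξ : π.sobolev (1 / 2)) :
    HasSum (fun k : ℤ => π.boundedMode k (fourierCoeff X.1 k) (π.sqrtEnergy ξ))
      (π.sobolevOp X ξ) :=
  (π.summable_boundedMode X).hasSum.mapL (ContinuousLinearMap.apply ℂ H (π.sqrtEnergy ξ))

theorem hasSum_sobolevOp_of_mem (X : sobolevLoops 𝔤 (3 / 2)) {n : ℕ} {ξ : π.smooth}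
    (hξ : (ξ : H) ∈ π.space n) (h : (ξ : H) ∈ π.sobolev (1 / 2)) :
    HasSum (fun k : ℤ => (π.modeOp k (fourierCoeff X.1 k) ξ : H)) (π.sobolevOp X ⟨ξ, h⟩) :=
  (π.hasSum_sobolevOp_modes X ⟨ξ, h⟩).congr_fun fun k => (π.boundedMode_of_mem k _ hξ h).symm

/-- `π(X) ξ` is the sum of the vectors `π(X) P_n ξ`, so that identities between such operators can
be checked on the energy spaces. -/
theorem hasSum_sobolevOp_proj (X : sobolevLoops 𝔤 (3 / 2)) (ξ : π.sobolev (1 / 2)) :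
    HasSum (fun n : ℕ => π.sobolevOp X (π.projSobolev (1 / 2) n (ξ : H))) (π.sobolevOp X ξ) := by
  refine ((π.hasSum_proj (π.sqrtEnergy ξ)).mapL _).congr_fun fun n => ?_
  rw [π.sobolevOp_apply, π.sqrtEnergy_projSobolev]

end PositiveEnergyRep

/-! ### Fourier coefficients of products -/

section Convolution

theorem hasSum_fourierCoeff_mul (f g : Lp ℂ 2 (AddCircle.haarAddCircle : Measure Circ)) (j : ℤ) :
    HasSum (fun k : ℤ => fourierCoeff f k * fourierCoeff g (j - k))
      (fourierCoeff (fun θ => f θ * g θ) j) := by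
  have hm : MemLp (fun θ : Circ => star (fourier (-j) θ * g θ)) 2 AddCircle.haarAddCircle := by
    refine (Lp.memLp g).of_le ?_ (Filter.Eventually.of_forall fun θ => ?_)
    · exact continuous_star.comp_aestronglyMeasurable
        ((fourier (-j)).continuous.aestronglyMeasurable.mul (Lp.aestronglyMeasurable g))
    · rw [norm_star, norm_mul, fourier_apply, Circle.norm_coe, one_mul]
  set x := hm.toLp _ with hx
  have hxe := hm.coeFn_toLp
  have h := (fourierBasis (T := 2 * Real.pi)).hasSum_inner_mul_inner x f
  have h1 : ⟪x, f⟫_ℂ = fourierCoeff (fun θ => f θ * g θ) j := by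
    rw [L2.inner_def, fourierCoeff]
    refine integral_congr_ae ?_
    filter_upwards [hxe] with θ hθ
    rw [hx, hθ, RCLike.inner_apply, smul_eq_mul, starRingEnd_apply, star_star]
    ring
  rw [h1] at h
  refine h.congr_fun fun k => ?_
  rw [← inner_conj_symm x, ← HilbertBasis.repr_apply_apply, ← HilbertBasis.repr_apply_apply,
    fourierBasis_repr, fourierBasis_repr, mul_comm]
  congr 1
  rw [fourierCoeff, fourierCoeff, ← integral_conj]
  refine integral_congr_ae ?_
  filter_upwards [hxe] with θ hθ
  rw [hx, hθ, smul_eq_mul, smul_eq_mul, map_mul, starRingEnd_apply, starRingEnd_apply, star_star,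
    ← starRingEnd_apply, ← fourier_neg, neg_neg, ← mul_assoc, ← fourier_add]
  congr 3
  ring

theorem fourierCoeff_compLp {E F : Type*} [NormedAddCommGroup E] [NormedSpace ℂ E]
    [CompleteSpace E] [NormedAddCommGroup F] [NormedSpace ℂ F] [CompleteSpace F] (φ : E →L[ℂ] F)
    (X : Lp E 2 (AddCircle.haarAddCircle : Measure Circ)) (k : ℤ) :
    fourierCoeff (φ.compLp X) k = φ (fourierCoeff X k) := by
  rw [fourierCoeff, fourierCoeff, ← φ.integral_comp_comm (integrable_fourier_smul X _)]
  refine integral_congr_ae ?_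
  filter_upwards [φ.coeFn_compLp X] with θ hθ
  rw [hθ, map_smul]

/-- The convolution formula for Fourier coefficients, reduced to Parseval's identity by expanding
the loops in a basis. -/
theorem hasSum_fourierCoeff_bilin {E F : Type*} [NormedAddCommGroup E] [NormedSpace ℂ E]
    [FiniteDimensional ℂ E] [NormedAddCommGroup F] [NormedSpace ℂ F]
    [CompleteSpace F] (β : E →ₗ[ℂ] E →ₗ[ℂ] F)
    (X Y : Lp E 2 (AddCircle.haarAddCircle : Measure Circ)) (j : ℤ) :
    HasSum (fun k : ℤ => β (fourierCoeff X k) (fourierCoeff Y (j - k)))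
      (fourierCoeff (fun θ => β (X θ) (Y θ)) j) := by
  have : CompleteSpace E := FiniteDimensional.complete ℂ E
  set b := Module.finBasis ℂ E
  set φ := fun i => LinearMap.toContinuousLinearMap (b.coord i)
  have hexp : ∀ x y : E, β x y = ∑ p : _ × _, (φ p.1 x * φ p.2 y) • β (b p.1) (b p.2) := by
    intro x y
    conv_lhs => rw [← b.sum_repr x, ← b.sum_repr y]
    simp only [map_sum, map_smul, LinearMap.sum_apply, LinearMap.smul_apply,
      Finset.smul_sum, smul_smul]
    rw [Fintype.sum_prod_type_right]
    refine Finset.sum_congr rfl fun i _ => Finset.sum_congr rfl fun i' _ => ?_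
    rw [mul_comm]
    rfl
  have hint : ∀ p : Fin _ × Fin _, Integrable
      (fun θ => (((φ p.1).compLp X) θ * ((φ p.2).compLp Y) θ) • β (b p.1) (b p.2))
      AddCircle.haarAddCircle := fun p =>
    ((Lp.memLp _).integrable_mul (Lp.memLp _)).smul_const _
  have hR : fourierCoeff (fun θ => β (X θ) (Y θ)) j = ∑ p : Fin _ × Fin _,
      fourierCoeff (fun θ => ((φ p.1).compLp X) θ * ((φ p.2).compLp Y) θ) j
        • β (b p.1) (b p.2) := by
    have h1 : fourierCoeff (fun θ => β (X θ) (Y θ)) j = fourierCoeff (fun θ => ∑ p : Fin _ × Fin _,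
        (((φ p.1).compLp X) θ * ((φ p.2).compLp Y) θ) • β (b p.1) (b p.2)) j := by
      refine integral_congr_ae ?_
      have h2 : ∀ᵐ θ ∂(AddCircle.haarAddCircle : Measure Circ), ∀ i, (φ i).compLp X θ = φ i (X θ) :=
        ae_all_iff.2 fun i => (φ i).coeFn_compLp X
      have h3 : ∀ᵐ θ ∂(AddCircle.haarAddCircle : Measure Circ), ∀ i, (φ i).compLp Y θ = φ i (Y θ) :=
        ae_all_iff.2 fun i => (φ i).coeFn_compLp Y
      filter_upwards [h2, h3] with θ hθ hθ'
      simp only [hθ, hθ']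
      rw [hexp]
    rw [h1]
    have h4 := fourierCoeff.sum Finset.univ (fun (p : Fin _ × Fin _) (θ : Circ) =>
      (((φ p.1).compLp X) θ * ((φ p.2).compLp Y) θ) • β (b p.1) (b p.2)) (fun p _ => hint p)
    have h5 := congrFun h4 j
    rw [Finset.sum_apply] at h5
    refine (Eq.trans ?_ h5).trans (Finset.sum_congr rfl fun p _ => ?_)
    · congr 1
      ext θ
      rw [Finset.sum_apply]
    · rw [fourierCoeff, fourierCoeff, ← integral_smul_const]
      simp only [smul_assoc]
  rw [hR]
  have hs := hasSum_sum (s := Finset.univ) fun (p : Fin _ × Fin _) _ =>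
    (hasSum_fourierCoeff_mul ((φ p.1).compLp X) ((φ p.2).compLp Y) j).smul_const
      (β (b p.1) (b p.2))
  refine hs.congr_fun fun k => ?_
  rw [hexp]
  simp only [fourierCoeff_compLp]

end Convolution

/-! ### Forms on `H^{1/2}` -/

namespace EnergyGrading

variable {H : Type*} [NormedAddCommGroup H] [InnerProductSpace ℂ H] [CompleteSpace H]
  (E : EnergyGrading H)

theorem ext_inner_smooth {u v : H} (h : ∀ η : E.smooth, ⟪(η : H), u⟫_ℂ = ⟪(η : H), v⟫_ℂ) :
    u = v := by
  refine sub_eq_zero.1 (E.ext_proj fun m => ?_)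
  have h1 := h (E.projSmooth m (u - v))
  rw [← sub_eq_zero, ← inner_sub_right, E.coe_projSmooth,
    ← E.proj_of_mem (E.proj_mem m (u - v)), E.inner_proj_left] at h1
  rw [map_zero]
  exact inner_self_eq_zero.1 h1

/-- A form on `H^{1/2}` whose value at `(ξ, η)` is, in each variable separately, the sum of its
values at the components of `ξ` or `η` in the energy spaces. -/
def IsBlockSummable (F : E.sobolev (1 / 2) → E.sobolev (1 / 2) → ℂ) : Prop :=
  (∀ ξ η : E.sobolev (1 / 2), HasSum (fun n : ℕ => F ξ (E.projSobolev (1 / 2) n (η : H))) (F ξ η)) ∧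
    ∀ ξ η : E.sobolev (1 / 2), HasSum (fun n : ℕ => F (E.projSobolev (1 / 2) n (ξ : H)) η) (F ξ η)

variable {E}

theorem isBlockSummable_inner {A B : E.sobolev (1 / 2) →ₗ[ℂ] H}
    (hA : ∀ ξ : E.sobolev (1 / 2), HasSum
      (fun n : ℕ => A (E.projSobolev (1 / 2) n (ξ : H))) (A ξ))
    (hB : ∀ ξ : E.sobolev (1 / 2), HasSum
      (fun n : ℕ => B (E.projSobolev (1 / 2) n (ξ : H))) (B ξ)) :
    E.IsBlockSummable fun ξ η => ⟪A ξ, B η⟫_ℂ := by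
  refine ⟨fun ξ η => (hB η).mapL (innerSL ℂ (A ξ)), fun ξ η => ?_⟩
  have h := ((hA ξ).mapL (innerSL ℂ (B η))).star
  simpa using h

theorem IsBlockSummable.add {F G : E.sobolev (1 / 2) → E.sobolev (1 / 2) → ℂ}
    (hF : E.IsBlockSummable F) (hG : E.IsBlockSummable G) :
    E.IsBlockSummable fun ξ η => F ξ η + G ξ η :=
  ⟨fun ξ η => (hF.1 ξ η).add (hG.1 ξ η), fun ξ η => (hF.2 ξ η).add (hG.2 ξ η)⟩

theorem IsBlockSummable.sub {F G : E.sobolev (1 / 2) → E.sobolev (1 / 2) → ℂ}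
    (hF : E.IsBlockSummable F) (hG : E.IsBlockSummable G) :
    E.IsBlockSummable fun ξ η => F ξ η - G ξ η :=
  ⟨fun ξ η => (hF.1 ξ η).sub (hG.1 ξ η), fun ξ η => (hF.2 ξ η).sub (hG.2 ξ η)⟩

theorem IsBlockSummable.const_mul {F : E.sobolev (1 / 2) → E.sobolev (1 / 2) → ℂ}
    (hF : E.IsBlockSummable F) (c : ℂ) : E.IsBlockSummable fun ξ η => c * F ξ η :=
  ⟨fun ξ η => (hF.1 ξ η).mul_left c, fun ξ η => (hF.2 ξ η).mul_left c⟩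

theorem IsBlockSummable.ext {F G : E.sobolev (1 / 2) → E.sobolev (1 / 2) → ℂ}
    (hF : E.IsBlockSummable F) (hG : E.IsBlockSummable G)
    (h : ∀ (m n : ℕ) (ξ η : E.smooth), (ξ : H) ∈ E.space m → (η : H) ∈ E.space n →
      F ⟨ξ, E.smooth_le_sobolev_half ξ.2⟩ ⟨η, E.smooth_le_sobolev_half η.2⟩
        = G ⟨ξ, E.smooth_le_sobolev_half ξ.2⟩ ⟨η, E.smooth_le_sobolev_half η.2⟩)
    (ξ η : E.sobolev (1 / 2)) : F ξ η = G ξ η := by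
  refine (hF.1 ξ η).unique ((hG.1 ξ η).congr_fun fun n => ?_)
  refine (hF.2 ξ _).unique ((hG.2 ξ _).congr_fun fun m => ?_)
  exact h m n (E.projSmooth m ξ) (E.projSmooth n η) (E.proj_mem m _) (E.proj_mem n _)

end EnergyGrading

namespace PositiveEnergyRep

variable {𝔤 : Type*} [NormedLieRing 𝔤] [NormedLieAlgebra 𝔤]
    [FiniteDimensional ℂ 𝔤] [LieAlgebra.IsSimple ℂ 𝔤]
    [StarAddMonoid 𝔤] [StarModule ℂ 𝔤] [NormedStarGroup 𝔤]
    {𝔥 : LieSubalgebra ℂ 𝔤} [𝔥.IsCartanSubalgebra]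
    {H : Type*} [NormedAddCommGroup H] [InnerProductSpace ℂ H] [CompleteSpace H]
    (π : PositiveEnergyRep 𝔤 𝔥 H)

/-! ### The extension agrees with `π` on smooth loops -/

/-- The matrix element of `π(X)` from `H(n)` to `H(m)` only depends on the Fourier coefficient of
`X` of index `k = n - m`. Indeed a smooth loop without `k`-th Fourier coefficient is of the form
`Ẏ - ik Y`, and `[d, π(Y)] = i π(Ẏ)` makes its matrix element vanish. -/
theorem proj_op (X : smoothLoops 𝔤) {k : ℤ} {n m : ℕ} (hk : (m : ℤ) + k = n) {ξ : π.smooth}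
    (hξ : (ξ : H) ∈ π.space n) :
    π.proj m (π.op X ξ : H) = π.proj m (π.modeOp k (fourierCoeff X.1 k) ξ : H) := by
  have h0 : fourierCoeff (X - smoothLoops.single k (fourierCoeff X.1 k)).1 k = 0 := by
    have h1 := congrFun (fourierCoeff.add (smoothLoops.integrable X)
      (smoothLoops.integrable (-smoothLoops.single k (fourierCoeff X.1 k)))) k
    have h2 : fourierCoeff (-smoothLoops.single k (fourierCoeff X.1 k)).1 k
        = -fourierCoeff X.1 k := by
      rw [← map_neg, smoothLoops.fourierCoeff_single]
    rw [sub_eq_add_neg]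
    refine h1.trans ?_
    rw [Pi.add_apply, h2, add_neg_cancel]
  obtain ⟨Y, hY⟩ := smoothLoops.exists_dot_sub_eq _ k h0
  have h3 := congrArg (fun T : Module.End ℂ π.smooth => π.proj m (T ξ : H))
    (π.energy_commutator Y)
  simp only [LinearMap.sub_apply, Module.End.mul_apply, LinearMap.smul_apply,
    π.energy_of_mem hξ, map_smul, Submodule.coe_sub, Submodule.coe_smul, map_sub,
    π.proj_energy] at h3
  have h4 := congrArg (fun Z : smoothLoops 𝔤 => π.proj m (π.op Z ξ : H)) hY
  simp only [map_sub, map_smul, LinearMap.sub_apply, LinearMap.smul_apply, Submodule.coe_sub,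
    Submodule.coe_smul] at h4
  refine sub_eq_zero.1 (h4.symm.trans ?_)
  have h5 : π.proj m (π.op (smoothLoops.dot Y) ξ : H)
      = (-Complex.I) • Complex.I • π.proj m (π.op (smoothLoops.dot Y) ξ : H) := by
    rw [smul_smul, neg_mul, Complex.I_mul_I, neg_neg, one_smul]
  have hk' : (k : ℂ) = n - m := by
    have : ((m + k : ℤ) : ℂ) = (n : ℤ) := by rw [hk]
    push_cast at this
    linear_combination this
  rw [h5, ← h3, hk']
  module

theorem proj_sobolevOp (X : sobolevLoops 𝔤 (3 / 2)) {k : ℤ} {n m : ℕ} (hk : (m : ℤ) + k = n)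
    {ξ : π.smooth} (hξ : (ξ : H) ∈ π.space n) (h : (ξ : H) ∈ π.sobolev (1 / 2)) :
    π.proj m (π.sobolevOp X ⟨ξ, h⟩) = π.proj m (π.modeOp k (fourierCoeff X.1 k) ξ : H) := by
  refine ((π.hasSum_sobolevOp_of_mem X hξ h).mapL (π.proj m)).unique ?_
  refine hasSum_single k fun l hl => ?_
  exact π.proj_modeOp (by omega) hξ

theorem sobolevOp_eq_op {X : smoothLoops 𝔤} {X' : sobolevLoops 𝔤 (3 / 2)}
    (hX : X'.1 =ᵐ[AddCircle.haarAddCircle] X.1) (ξ : π.smooth) (h : (ξ : H) ∈ π.sobolev (1 / 2)) :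
    π.sobolevOp X' ⟨ξ, h⟩ = (π.op X ξ : H) := by
  have hblock : ∀ (n : ℕ) (ξ : π.smooth) (_ : (ξ : H) ∈ π.space n)
      (h : (ξ : H) ∈ π.sobolev (1 / 2)), π.sobolevOp X' ⟨ξ, h⟩ = (π.op X ξ : H) := by
    intro n ξ hξ h
    refine π.ext_proj fun m => ?_
    rw [π.proj_sobolevOp X' (k := n - m) (by omega) hξ, π.proj_op X (k := n - m) (by omega) hξ,
      fourierCoeff_congr_ae hX]
  refine π.ext_inner_smooth fun η => ?_
  have h1 := (π.hasSum_sobolevOp_proj X' ⟨ξ, h⟩).mapL (innerSL ℂ (η : H))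
  refine h1.unique ?_
  have h2 := (π.hasSum_proj (ξ : H)).mapL (innerSL ℂ (π.op (smoothLoops.conj X) η : H))
  have h3 := π.formal_adjoint X η
  simp only [innerSL_apply_apply] at h2 ⊢
  rw [h3]
  refine h2.congr_fun fun n => ?_
  rw [← π.coe_projSmooth, ← h3]
  exact congrArg _ (hblock n (π.projSmooth n ξ) (π.proj_mem n _) _)

/-! ### Formal adjoints and commutation relations -/

theorem hasSum_coe (ξ : π.sobolev (1 / 2)) :
    HasSum (fun n : ℕ => (π.sobolev (1 / 2)).subtype (π.projSobolev (1 / 2) n (ξ : H)))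
      ((π.sobolev (1 / 2)).subtype ξ) := π.hasSum_proj (ξ : H)

theorem hasSum_sobolevOp_conj_of_mem (X : sobolevLoops 𝔤 (3 / 2)) {m : ℕ} {ξ : π.smooth}
    (hξ : (ξ : H) ∈ π.space m) (h : (ξ : H) ∈ π.sobolev (1 / 2)) (w : H) :
    HasSum (fun k : ℤ => ⟪(π.modeOp (-k) (star (fourierCoeff X.1 k)) ξ : H), w⟫_ℂ)
      ⟪π.sobolevOp (sobolevLoops.conj X) ⟨ξ, h⟩, w⟫_ℂ := by
  have h1 := (((π.hasSum_sobolevOp_of_mem (sobolevLoops.conj X) hξ h).mapL (innerSL ℂ w)).star)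
  have h2 := (Equiv.neg ℤ).hasSum_iff.2 h1
  simpa [Function.comp_def, sobolevLoops.fourierCoeff_conj] using h2

theorem inner_sobolevOp_conj (X : sobolevLoops 𝔤 (3 / 2)) (ξ η : π.sobolev (1 / 2)) :
    ⟪π.sobolevOp (sobolevLoops.conj X) ξ, (η : H)⟫_ℂ = ⟪(ξ : H), π.sobolevOp X η⟫_ℂ := by
  refine EnergyGrading.IsBlockSummable.ext
    (EnergyGrading.isBlockSummable_inner (π.hasSum_sobolevOp_proj _) π.hasSum_coe)
    (EnergyGrading.isBlockSummable_inner π.hasSum_coe (π.hasSum_sobolevOp_proj _))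
    (fun m n ξ η hξ hη => ?_) ξ η
  refine (π.hasSum_sobolevOp_conj_of_mem X hξ _ _).unique ?_
  refine ((π.hasSum_sobolevOp_of_mem X hη _).mapL (innerSL ℂ (ξ : H))).congr_fun fun k => ?_
  exact (π.inner_modeOp k (fourierCoeff X.1 k) ξ η).symm

theorem hasSum_inner_sobolevOp_sobolevOp (X Y : sobolevLoops 𝔤 (3 / 2)) {j : ℤ} {m n : ℕ}
    (hj : (m : ℤ) + j = n) {ξ η : π.smooth} (hξ : (ξ : H) ∈ π.space m)
    (hη : (η : H) ∈ π.space n) (h : (ξ : H) ∈ π.sobolev (1 / 2))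
    (h' : (η : H) ∈ π.sobolev (1 / 2)) :
    HasSum (fun k : ℤ => ⟪ξ, π.modeOp k (fourierCoeff X.1 k)
        (π.modeOp (j - k) (fourierCoeff Y.1 (j - k)) η)⟫_ℂ)
      ⟪π.sobolevOp (sobolevLoops.conj X) ⟨ξ, h⟩, π.sobolevOp Y ⟨η, h'⟩⟫_ℂ := by
  refine (π.hasSum_sobolevOp_conj_of_mem X hξ h _).congr_fun fun k => ?_
  rw [π.inner_modeOp]
  have h1 := (π.hasSum_sobolevOp_of_mem Y hη h').mapL
    (innerSL ℂ (π.modeOp (-k) (star (fourierCoeff X.1 k)) ξ : H))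
  refine ((h1.unique (hasSum_single (j - k) fun l hl => ?_)).symm)
  exact π.inner_modeOp_eq_zero _ _ hξ hη (by omega)

theorem sobolevOp_commutator (X Y Z : sobolevLoops 𝔤 (3 / 2)) (Y' : L2Loops 𝔤)
    (hZ : Z.1 =ᵐ[AddCircle.haarAddCircle] fun θ => ⁅X.1 θ, Y.1 θ⁆) (hY : IsWeakDeriv Y.1 Y')
    (ξ η : π.sobolev (1 / 2)) :
    ⟪π.sobolevOp (sobolevLoops.conj X) ξ, π.sobolevOp Y η⟫_ℂ
        - ⟪π.sobolevOp (sobolevLoops.conj Y) ξ, π.sobolevOp X η⟫_ℂ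
      = ⟪(ξ : H), π.sobolevOp Z η⟫_ℂ + Complex.I * π.level *
        (∫ θ, basicForm 𝔥 (X.1 θ) (Y' θ) ∂AddCircle.haarAddCircle) * ⟪(ξ : H), (η : H)⟫_ℂ := by
  refine EnergyGrading.IsBlockSummable.ext
    ((EnergyGrading.isBlockSummable_inner (π.hasSum_sobolevOp_proj _)
      (π.hasSum_sobolevOp_proj _)).sub
      (EnergyGrading.isBlockSummable_inner (π.hasSum_sobolevOp_proj _)
      (π.hasSum_sobolevOp_proj _)))
    ((EnergyGrading.isBlockSummable_inner π.hasSum_coe (π.hasSum_sobolevOp_proj _)).add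
      ((EnergyGrading.isBlockSummable_inner π.hasSum_coe π.hasSum_coe).const_mul _))
    (fun m n ξ η hξ hη => ?_) ξ η
  obtain ⟨j, hj⟩ : ∃ j : ℤ, (m : ℤ) + j = n := ⟨n - m, by omega⟩
  have h1 := π.hasSum_inner_sobolevOp_sobolevOp X Y hj hξ hη
    (π.smooth_le_sobolev_half ξ.2) (π.smooth_le_sobolev_half η.2)
  have h2 := (Equiv.subLeft j).hasSum_iff.2 (π.hasSum_inner_sobolevOp_sobolevOp Y X hj hξ hη
    (π.smooth_le_sobolev_half ξ.2) (π.smooth_le_sobolev_half η.2))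
  refine (h1.sub h2).unique ?_
  -- the contribution of the brackets of the modes
  have h3 : HasSum (fun k : ℤ => ⟪ξ, π.modeOp j ⁅fourierCoeff X.1 k, fourierCoeff Y.1 (j - k)⁆ η⟫_ℂ)
      ⟪(ξ : H), π.sobolevOp Z ⟨η, π.smooth_le_sobolev_half η.2⟩⟫_ℂ := by
    have : CompleteSpace 𝔤 := FiniteDimensional.complete ℂ 𝔤
    have h4 := hasSum_fourierCoeff_bilin (LieModule.toEnd ℂ 𝔤 𝔤 : 𝔤 →ₗ[ℂ] Module.End ℂ 𝔤)
      X.1 Y.1 j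
    let ψ : 𝔤 →ₗ[ℂ] ℂ := (innerₛₗ ℂ ξ) ∘ₗ (LinearMap.applyₗ η) ∘ₗ π.modeOp j
    have h5 := h4.mapL (LinearMap.toContinuousLinearMap ψ)
    have h6 : ⟪(ξ : H), π.sobolevOp Z ⟨η, π.smooth_le_sobolev_half η.2⟩⟫_ℂ
        = ψ (fourierCoeff (fun θ => ⁅X.1 θ, Y.1 θ⁆) j) := by
      rw [← fourierCoeff_congr_ae hZ, ← π.proj_of_mem hξ, π.inner_proj_left,
        π.proj_sobolevOp Z hj hη, ← π.inner_proj_left, π.proj_of_mem hξ]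
      rfl
    rw [h6]
    exact h5
  -- the contribution of the central terms
  have h7 : HasSum (fun k : ℤ => (if j = 0 then
      (π.level * k * basicForm 𝔥 (fourierCoeff X.1 k) (fourierCoeff Y.1 (j - k)) : ℂ) else 0)
        * ⟪ξ, η⟫_ℂ)
      (Complex.I * π.level * (∫ θ, basicForm 𝔥 (X.1 θ) (Y' θ) ∂AddCircle.haarAddCircle)
        * ⟪(ξ : H), (η : H)⟫_ℂ) := by
    by_cases hj0 : j = 0
    · subst hj0
      refine HasSum.mul_right _ ?_
      have h8 := hasSum_fourierCoeff_bilin (basicForm 𝔥) X.1 Y' 0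
      have h9 : fourierCoeff (fun θ => basicForm 𝔥 (X.1 θ) (Y' θ)) 0
          = ∫ θ, basicForm 𝔥 (X.1 θ) (Y' θ) ∂AddCircle.haarAddCircle := by
        simp [fourierCoeff]
      rw [h9] at h8
      refine (h8.mul_left (Complex.I * π.level)).congr_fun fun k => ?_
      rw [if_pos rfl, hY, map_smul, smul_eq_mul]
      push_cast
      linear_combination ((k : ℂ) * π.level *
        basicForm 𝔥 (fourierCoeff X.1 k) (fourierCoeff Y.1 (0 - k))) * Complex.I_mul_I
    · rw [π.inner_eq_zero (by omega) hξ hη, mul_zero]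
      simp only [if_neg hj0, zero_mul]
      exact hasSum_zero
  refine (h3.add h7).congr_fun fun k => ?_
  rw [← inner_smul_right, ← inner_add_right, Function.comp_apply, Equiv.subLeft_apply,
    sub_sub_cancel, ← inner_sub_right, π.modeOp_commutator, add_sub_cancel]
  congr 1
  rw [add_assoc, add_sub_cancel_left]

end PositiveEnergyRep

/-! ### Fejér means -/

/-- The weight of the Fejér mean of order `N` on the energy space `H(n)`. The truncated
subtraction makes it vanish for `n ≥ N - 1`. -/
noncomputable def fejerWeight (N n : ℕ) : ℝ := (N - 1 - n : ℕ) / N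

theorem fejerWeight_sub_sq_mul_le_aux (N : ℕ) {a b : ℕ} (hab : a ≤ b) :
    (fejerWeight N a - fejerWeight N b) ^ 2 * (1 + b) ≤ 2 * (1 + ((b : ℝ) - a)) := by
  have hab' : (a : ℝ) ≤ b := by exact_mod_cast hab
  rcases le_or_gt (N - 1) a with h | h
  · have h1 : N - 1 - a = 0 := by omega
    have h2 : N - 1 - b = 0 := by omega
    rw [fejerWeight, fejerWeight, h1, h2]
    simp only [sub_self]
    linarith
  · obtain ⟨p, hp, hpN, hpd⟩ : ∃ p : ℕ, N - 1 - a = (N - 1 - b) + p ∧ p ≤ N ∧ p + a ≤ b :=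
      ⟨(N - 1 - a) - (N - 1 - b), by omega, by omega, by omega⟩
    have hN : (0 : ℝ) < N := by
      have : 0 < N := by omega
      exact_mod_cast this
    have h1 : fejerWeight N a - fejerWeight N b = p / N := by
      rw [fejerWeight, fejerWeight, hp]
      push_cast
      ring
    have haN : (a : ℝ) + 1 ≤ N := by
      have : a + 1 ≤ N := by omega
      exact_mod_cast this
    have hpN' : (p : ℝ) ≤ N := by exact_mod_cast hpN
    have hpd' : (p : ℝ) + a ≤ b := by exact_mod_cast hpd
    have hp0 : (0 : ℝ) ≤ p := p.cast_nonneg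
    rw [h1, div_pow, div_mul_eq_mul_div, div_le_iff₀ (by positivity)]
    have h2 : (p : ℝ) ^ 2 * (1 + a) ≤ ((b : ℝ) - a) * N ^ 2 :=
      calc (p : ℝ) ^ 2 * (1 + a) = p * p * (1 + a) := by ring
        _ ≤ ((b : ℝ) - a) * N * N := by gcongr <;> linarith
        _ = _ := by ring
    have h3 : (p : ℝ) ^ 2 * (b - a) ≤ N ^ 2 * (b - a) :=
      mul_le_mul_of_nonneg_right (pow_le_pow_left₀ hp0 hpN' 2) (by linarith)
    nlinarith [sq_nonneg (N : ℝ)]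

theorem fejerWeight_sub_sq_mul_le (N : ℕ) {m n : ℕ} {k : ℤ} (hk : (m : ℤ) + k = n) :
    (fejerWeight N m - fejerWeight N n) ^ 2 * (1 + (max n m : ℕ)) ≤ 2 * (1 + |(k : ℝ)|) := by
  have hk' : (k : ℝ) = n - m := by
    have : ((m + k : ℤ) : ℝ) = (n : ℤ) := by rw [hk]
    push_cast at this
    linarith
  rcases le_total m n with h | h
  · refine (le_of_eq ?_).trans ((fejerWeight_sub_sq_mul_le_aux N h).trans ?_)
    · rw [max_eq_left h]
    · rw [← hk']
      gcongr
      exact le_abs_self _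
  · refine (le_of_eq ?_).trans ((fejerWeight_sub_sq_mul_le_aux N h).trans ?_)
    · rw [max_eq_right h]
      ring
    · rw [show (m : ℝ) - n = -k by rw [hk']; ring]
      gcongr
      exact neg_le_abs _

namespace EnergyGrading

variable {H : Type*} [NormedAddCommGroup H] [InnerProductSpace ℂ H] [CompleteSpace H]
  (E : EnergyGrading H)

/-- The Fejér mean of order `N`, that is, the average of the partial sums with `0, …, N - 1` terms
of the series `ξ = ∑ P_n ξ`, as an operator from `H` to `H^{1/2}`. -/
noncomputable def fejer (N : ℕ) : H →ₗ[ℂ] E.sobolev (1 / 2) :=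
  (((N : ℝ)⁻¹ : ℝ) : ℂ) • ∑ i ∈ Finset.range N, ∑ n ∈ Finset.range i, E.projSobolev (1 / 2) n

/-- The Fejér mean of order `N`, as a bounded operator on `H`. -/
noncomputable def fejerL (N : ℕ) : H →L[ℂ] H :=
  (((N : ℝ)⁻¹ : ℝ) : ℂ) • ∑ i ∈ Finset.range N, ∑ n ∈ Finset.range i, E.proj n

theorem map_fejer (A : E.sobolev (1 / 2) →ₗ[ℂ] H) (N : ℕ) (ξ : H) :
    A (E.fejer N ξ) = ((N : ℝ)⁻¹ : ℝ) • ∑ i ∈ Finset.range N, ∑ n ∈ Finset.range i,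
      A (E.projSobolev (1 / 2) n ξ) := by
  rw [fejer, LinearMap.smul_apply, map_smul, Complex.coe_smul]
  simp only [LinearMap.sum_apply, map_sum]

theorem coe_fejer (N : ℕ) (ξ : H) : (E.fejer N ξ : H) = E.fejerL N ξ := by
  have h := E.map_fejer (E.sobolev (1 / 2)).subtype N ξ
  simp only [Submodule.subtype_apply, coe_projSobolev] at h
  rw [h, fejerL]
  simp only [_root_.smul_apply, _root_.sum_apply, Complex.coe_smul]

theorem tendsto_map_fejer {A : E.sobolev (1 / 2) →ₗ[ℂ] H} {ξ v : H}
    (h : HasSum (fun n : ℕ => A (E.projSobolev (1 / 2) n ξ)) v) :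
    Filter.Tendsto (fun N => A (E.fejer N ξ)) Filter.atTop (nhds v) := by
  simp only [map_fejer]
  exact h.tendsto_sum_nat.cesaro_smul

theorem tendsto_fejer (ξ : H) :
    Filter.Tendsto (fun N => (E.fejer N ξ : H)) Filter.atTop (nhds ξ) :=
  E.tendsto_map_fejer (A := (E.sobolev (1 / 2)).subtype) (E.hasSum_proj ξ)

theorem inner_fejer_left (N : ℕ) (ξ η : H) :
    ⟪(E.fejer N ξ : H), η⟫_ℂ = ⟪ξ, (E.fejer N η : H)⟫_ℂ := by
  simp only [coe_fejer, fejerL, _root_.smul_apply, _root_.sum_apply,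
    inner_smul_left, inner_smul_right, sum_inner, inner_sum, inner_proj_left, Complex.conj_ofReal]

theorem card_filter_range_lt (N n : ℕ) :
    ((Finset.range N).filter fun i => n < i).card = N - 1 - n := by
  have : (Finset.range N).filter (fun i => n < i) = Finset.Ioo n N := by
    ext i
    simp [and_comm]
  rw [this, Nat.card_Ioo]
  omega

theorem fejerL_of_mem (N : ℕ) {n : ℕ} {ξ : H} (h : ξ ∈ E.space n) :
    E.fejerL N ξ = (fejerWeight N n : ℂ) • ξ := by
  have h1 : ∀ i, ∑ l ∈ Finset.range i, E.proj l ξ = if n < i then ξ else 0 := fun i => by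
    split_ifs with hi
    · rw [Finset.sum_eq_single_of_mem n (Finset.mem_range.2 hi)
        fun l _ hl => E.proj_of_mem_ne hl h, E.proj_of_mem h]
    · refine Finset.sum_eq_zero fun l hl => E.proj_of_mem_ne (fun hln => hi ?_) h
      rw [← hln]
      exact Finset.mem_range.1 hl
  simp only [fejerL, _root_.smul_apply, _root_.sum_apply, h1]
  rw [← Finset.sum_filter, Finset.sum_const, card_filter_range_lt, ← Nat.cast_smul_eq_nsmul ℂ,
    smul_smul, fejerWeight]
  congr 1
  push_cast
  ring

theorem proj_fejerL (N n : ℕ) (ξ : H) :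
    E.proj n (E.fejerL N ξ) = (fejerWeight N n : ℂ) • E.proj n ξ := by
  refine ((E.hasSum_proj ξ).mapL (E.proj n ∘L E.fejerL N)).unique ?_
  convert hasSum_single n fun m hm => ?_ using 1
  · rw [ContinuousLinearMap.comp_apply, E.fejerL_of_mem N (E.proj_mem n ξ), map_smul,
      E.proj_of_mem (E.proj_mem n ξ)]
  · rw [ContinuousLinearMap.comp_apply, E.fejerL_of_mem N (E.proj_mem m ξ), map_smul,
      E.proj_of_mem_ne hm.symm (E.proj_mem m ξ), smul_zero]

theorem dense_sobolev_half : Dense (E.sobolev (1 / 2) : Set H) := fun ξ =>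
  mem_closure_of_tendsto (E.tendsto_fejer ξ) (Filter.Eventually.of_forall fun N => (E.fejer N ξ).2)

end EnergyGrading

/-! ### Adjoints -/

namespace PositiveEnergyRep

variable {𝔤 : Type*} [NormedLieRing 𝔤] [NormedLieAlgebra 𝔤]
    [FiniteDimensional ℂ 𝔤] [LieAlgebra.IsSimple ℂ 𝔤]
    [StarAddMonoid 𝔤] [StarModule ℂ 𝔤] [NormedStarGroup 𝔤]
    {𝔥 : LieSubalgebra ℂ 𝔤} [𝔥.IsCartanSubalgebra]
    {H : Type*} [NormedAddCommGroup H] [InnerProductSpace ℂ H] [CompleteSpace H]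
    (π : PositiveEnergyRep 𝔤 𝔥 H)

theorem norm_fejer_commutator_mode_le (N : ℕ) (k : ℤ) (x : 𝔤) (η : π.sobolev (1 / 2)) :
    ‖π.fejerL N (π.boundedMode k x (π.sqrtEnergy η))
        - π.boundedMode k x (π.sqrtEnergy (π.fejer N (η : H)))‖
      ≤ √2 * π.modeConst * (√(1 + |(k : ℝ)|) * ‖x‖) * ‖(η : H)‖ := by
  have hC := π.modeConst_nonneg
  have h1 := ((π.hasSum_boundedMode k x η).mapL (π.fejerL N)).sub
    (π.hasSum_boundedMode k x (π.fejer N (η : H)))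
  have hterm : ∀ n m : ℕ, (m : ℤ) + k = n →
      π.fejerL N (π.modeOp k x (π.projSmooth n (η : H)) : H)
        - (π.modeOp k x (π.projSmooth n (π.fejer N (η : H) : H)) : H)
      = ((fejerWeight N m - fejerWeight N n : ℝ) : ℂ)
        • (π.modeOp k x (π.projSmooth n (η : H)) : H) := by
    intro n m hmn
    have h2 : π.projSmooth n (π.fejer N (η : H) : H)
        = (fejerWeight N n : ℂ) • π.projSmooth n (η : H) := by
      refine Subtype.ext ?_
      rw [π.coe_projSmooth, π.coe_fejer, π.proj_fejerL]
      rfl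
    rw [h2, map_smul, π.fejerL_of_mem N (π.modeOp_mem x hmn (π.proj_mem n _)),
      Submodule.coe_smul, ← sub_smul, Complex.ofReal_sub]
  have hzero : ∀ n : ℕ, (n : ℤ) < k →
      π.fejerL N (π.modeOp k x (π.projSmooth n (η : H)) : H)
        - (π.modeOp k x (π.projSmooth n (π.fejer N (η : H) : H)) : H) = 0 := by
    intro n hn
    rw [π.modeOp_eq_zero x hn (π.proj_mem n _), π.modeOp_eq_zero x hn (π.proj_mem n _),
      Submodule.coe_zero, map_zero, sub_zero]
  have ho : Pairwise fun n n' : ℕ =>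
      ⟪π.fejerL N (π.modeOp k x (π.projSmooth n (η : H)) : H)
        - (π.modeOp k x (π.projSmooth n (π.fejer N (η : H) : H)) : H),
       π.fejerL N (π.modeOp k x (π.projSmooth n' (η : H)) : H)
        - (π.modeOp k x (π.projSmooth n' (π.fejer N (η : H) : H)) : H)⟫_ℂ = 0 := by
    intro n n' hnn'
    rcases lt_or_ge (n : ℤ) k with hk | hk
    · rw [hzero n hk, inner_zero_left]
    rcases lt_or_ge (n' : ℤ) k with hk' | hk'
    · rw [hzero n' hk', inner_zero_right]
    obtain ⟨m, hm⟩ := Int.eq_ofNat_of_zero_le (sub_nonneg.2 hk)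
    obtain ⟨m', hm'⟩ := Int.eq_ofNat_of_zero_le (sub_nonneg.2 hk')
    rw [hterm n m (by omega), hterm n' m' (by omega), inner_smul_left, inner_smul_right,
      π.inner_modeOp_eq_zero x x (π.proj_mem n _) (π.proj_mem n' _) (by omega), mul_zero, mul_zero]
  refine le_of_sq_le_sq ?_ (by positivity)
  rw [mul_pow]
  refine norm_sq_le_of_hasSum_orthogonal ho h1 (fun n => ?_)
    ((π.hasSum_norm_sq (η : H)).mul_left _)
  rcases lt_or_ge (n : ℤ) k with hk | hk
  · rw [hzero n hk, norm_zero, zero_pow two_ne_zero]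
    exact mul_nonneg (sq_nonneg _) (sq_nonneg _)
  obtain ⟨m, hm⟩ := Int.eq_ofNat_of_zero_le (sub_nonneg.2 hk)
  rw [hterm n m (by omega), norm_smul, mul_pow, Complex.norm_real, Real.norm_eq_abs, sq_abs]
  have h3 := π.norm_modeOp_le x (k := k) (n := n) (m := m) (ξ := π.projSmooth n (η : H))
    (by omega) (π.proj_mem n (η : H))
  have h4 := fejerWeight_sub_sq_mul_le N (m := m) (n := n) (k := k) (by omega)
  calc (fejerWeight N m - fejerWeight N n) ^ 2 * ‖(π.modeOp k x (π.projSmooth n (η : H)) : H)‖ ^ 2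
      ≤ (fejerWeight N m - fejerWeight N n) ^ 2 * (π.modeConst * ‖x‖ * √(1 + (max n m : ℕ))
          * ‖π.proj n (η : H)‖) ^ 2 := by gcongr; exact h3
    _ = ((fejerWeight N m - fejerWeight N n) ^ 2 * (1 + (max n m : ℕ)))
          * (π.modeConst ^ 2 * ‖x‖ ^ 2 * ‖π.proj n (η : H)‖ ^ 2) := by
        rw [mul_pow, mul_pow, mul_pow, Real.sq_sqrt (by positivity)]
        ring
    _ ≤ (2 * (1 + |(k : ℝ)|)) * (π.modeConst ^ 2 * ‖x‖ ^ 2 * ‖π.proj n (η : H)‖ ^ 2) := by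
        gcongr
    _ = _ := by
        rw [mul_pow, mul_pow, mul_pow, Real.sq_sqrt (by positivity), Real.sq_sqrt (by positivity)]
        ring

/-- The commutators of `π(X)` with the Fejér means are uniformly bounded on `H`: an entry of
`x(k)` of size `(1 + max(n, m))^{1/2}` is multiplied by a difference of weights, which makes it
`O((1 + |k|)^{1/2})`. -/
theorem norm_fejer_commutator_le (X : sobolevLoops 𝔤 (3 / 2)) (N : ℕ) (η : π.sobolev (1 / 2)) :
    ‖π.fejerL N (π.sobolevOp X η) - π.sobolevOp X (π.fejer N (η : H))‖
      ≤ (√2 * π.modeConst * ∑' k : ℤ, √(1 + |(k : ℝ)|) * ‖fourierCoeff X.1 k‖) * ‖(η : H)‖ := by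
  have h1 := ((π.hasSum_sobolevOp_modes X η).mapL (π.fejerL N)).sub
    (π.hasSum_sobolevOp_modes X (π.fejer N (η : H)))
  have h2 := ((summable_sqrt_mul_fourierCoeff X).hasSum.mul_left
    (√2 * π.modeConst)).mul_right ‖(η : H)‖
  rw [← h1.tsum_eq]
  exact tsum_of_norm_bounded h2 fun k => π.norm_fejer_commutator_mode_le N k _ η

/-- If `w` is the image of `ζ` under the adjoint of `π(X)`, then `π(X*) F_N ζ` tends to `w`, where
`F_N` is the Fejér mean. The difference `π(X*) F_N ζ - F_N w` is bounded by a multiple of `‖ζ‖`,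
uniformly in `N`, and it tends to zero for `ζ` in the dense subspace `H^{1/2}`. -/
theorem tendsto_sobolevOp_conj_fejer (X : sobolevLoops 𝔤 (3 / 2)) {ζ w : H}
    (h : ∀ η : π.sobolev (1 / 2), ⟪w, (η : H)⟫_ℂ = ⟪ζ, π.sobolevOp X η⟫_ℂ) :
    Filter.Tendsto (fun N => π.sobolevOp (sobolevLoops.conj X) (π.fejer N ζ)) Filter.atTop
      (nhds w) := by
  set K := √2 * π.modeConst * ∑' k : ℤ, √(1 + |(k : ℝ)|) * ‖fourierCoeff X.1 k‖ with hK
  have hK0 : 0 ≤ K := mul_nonneg (mul_nonneg (Real.sqrt_nonneg _) π.modeConst_nonneg)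
    (tsum_nonneg fun k => by positivity)
  have bound : ∀ (ζ w : H) (N : ℕ),
      (∀ η : π.sobolev (1 / 2), ⟪w, (η : H)⟫_ℂ = ⟪ζ, π.sobolevOp X η⟫_ℂ) →
      ‖π.sobolevOp (sobolevLoops.conj X) (π.fejer N ζ) - (π.fejer N w : H)‖ ≤ K * ‖ζ‖ := by
    intro ζ w N h
    set u := π.sobolevOp (sobolevLoops.conj X) (π.fejer N ζ) - (π.fejer N w : H) with hu
    -- tested against `H^{1/2}`, the vector `u` becomes the commutator of `π(X)` with the Fejér mean
    have h1 : ∀ η : π.sobolev (1 / 2), ‖⟪u, (η : H)⟫_ℂ‖ ≤ K * ‖ζ‖ * ‖(η : H)‖ := by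
      intro η
      have h2 : ⟪u, (η : H)⟫_ℂ
          = ⟪ζ, π.fejerL N (π.sobolevOp X η) - π.sobolevOp X (π.fejer N (η : H))⟫_ℂ := by
        rw [hu, inner_sub_left, π.inner_sobolevOp_conj, π.inner_fejer_left, π.inner_fejer_left, h,
          inner_sub_right, π.coe_fejer]
      rw [h2]
      refine (norm_inner_le_norm _ _).trans ?_
      calc ‖ζ‖ * _ ≤ ‖ζ‖ * (K * ‖(η : H)‖) := by
            gcongr
            exact π.norm_fejer_commutator_le X N η
        _ = _ := by ring
    have h3 : ‖⟪u, u⟫_ℂ‖ ≤ K * ‖ζ‖ * ‖u‖ := by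
      have h4 := π.tendsto_fejer u
      refine le_of_tendsto_of_tendsto' ((tendsto_const_nhds.inner h4).norm)
        (h4.norm.const_mul (K * ‖ζ‖)) fun M => ?_
      exact h1 (π.fejer M u)
    rw [inner_self_eq_norm_sq_to_K, norm_pow, RCLike.norm_ofReal, abs_norm, pow_two] at h3
    rcases (norm_nonneg u).eq_or_lt with h0 | h0
    · rw [← h0]
      positivity
    · exact le_of_mul_le_mul_right h3 h0
  have key : Filter.Tendsto (fun N => π.sobolevOp (sobolevLoops.conj X) (π.fejer N ζ)
      - (π.fejer N w : H)) Filter.atTop (nhds 0) := by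
    rw [Metric.tendsto_atTop]
    intro ε hε
    -- split `ζ` into an element `F_M ζ` of `H^{1/2}` and a small remainder
    obtain ⟨M, hM⟩ : ∃ M, ‖ζ - (π.fejer M ζ : H)‖ * K < ε / 2 := by
      have h1 := ((tendsto_const_nhds (x := ζ)).sub (π.tendsto_fejer ζ)).norm.mul_const K
      rw [sub_self, norm_zero, zero_mul] at h1
      exact (h1.eventually_lt_const (by positivity)).exists
    set ζ' := π.fejer M ζ
    have h2 : Filter.Tendsto (fun N => π.sobolevOp (sobolevLoops.conj X) (π.fejer N (ζ' : H))
        - (π.fejer N (π.sobolevOp (sobolevLoops.conj X) ζ') : H)) Filter.atTop (nhds 0) := by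
      have h3 := (π.tendsto_map_fejer (π.hasSum_sobolevOp_proj (sobolevLoops.conj X) ζ')).sub
        (π.tendsto_fejer (π.sobolevOp (sobolevLoops.conj X) ζ'))
      rwa [sub_self] at h3
    obtain ⟨N₀, hN₀⟩ := Metric.tendsto_atTop.1 h2 (ε / 2) (by positivity)
    refine ⟨N₀, fun N hN => ?_⟩
    have h4 := hN₀ N hN
    have h5 := bound (ζ - (ζ' : H)) (w - π.sobolevOp (sobolevLoops.conj X) ζ') N fun η => by
      rw [inner_sub_left, inner_sub_left, h, π.inner_sobolevOp_conj]
    rw [dist_zero_right] at h4 ⊢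
    have h6 : π.sobolevOp (sobolevLoops.conj X) (π.fejer N ζ) - (π.fejer N w : H)
        = (π.sobolevOp (sobolevLoops.conj X) (π.fejer N (ζ - (ζ' : H)))
            - (π.fejer N (w - π.sobolevOp (sobolevLoops.conj X) ζ') : H))
          + (π.sobolevOp (sobolevLoops.conj X) (π.fejer N (ζ' : H))
            - (π.fejer N (π.sobolevOp (sobolevLoops.conj X) ζ') : H)) := by
      simp only [map_sub, Submodule.coe_sub]
      abel
    rw [h6]
    refine (norm_add_le _ _).trans_lt ?_
    linarith
  have h7 := key.add (π.tendsto_fejer w)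
  simpa using h7

theorem dense_domain (X : sobolevLoops 𝔤 (3 / 2)) :
    Dense ((toUnbounded (π.sobolevOp X)).domain : Set H) := π.dense_sobolev_half

theorem isFormalAdjoint (X : sobolevLoops 𝔤 (3 / 2)) :
    (toUnbounded (π.sobolevOp X)).IsFormalAdjoint
      (toUnbounded (π.sobolevOp (sobolevLoops.conj X))) := by
  intro ξ η
  have h := π.inner_sobolevOp_conj X η ξ
  rw [← inner_conj_symm, ← inner_conj_symm (ξ : H)]
  exact congrArg _ h.symm

theorem isClosable (X : sobolevLoops 𝔤 (3 / 2)) :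
    (toUnbounded (π.sobolevOp X)).IsClosable := by
  have h := (π.isFormalAdjoint (sobolevLoops.conj X)).le_adjoint (π.dense_domain _)
  rw [sobolevLoops.conj_conj] at h
  exact (LinearPMap.adjoint_isClosed (π.dense_domain _)).isClosable.leIsClosable h

theorem adjoint_eq_closure (X : sobolevLoops 𝔤 (3 / 2)) :
    (toUnbounded (π.sobolevOp X)).adjoint
      = (toUnbounded (π.sobolevOp (sobolevLoops.conj X))).closure := by
  have hd := π.dense_domain X
  have hcl := LinearPMap.adjoint_isClosed hd
  refine le_antisymm (LinearPMap.le_of_le_graph ?_) ?_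
  · rw [← (π.isClosable (sobolevLoops.conj X)).graph_closure_eq_closure_graph]
    rintro ⟨ζ, w⟩ hζ
    obtain ⟨y, hy1, hy2⟩ := LinearPMap.mem_graph_iff _ |>.1 hζ
    have h1 : ∀ η : π.sobolev (1 / 2), ⟪w, (η : H)⟫_ℂ = ⟪ζ, π.sobolevOp X η⟫_ℂ := fun η => by
      have h2 := LinearPMap.adjoint_isFormalAdjoint hd y η
      rw [hy2, hy1] at h2
      exact h2
    refine mem_closure_of_tendsto
      ((π.tendsto_fejer ζ).prodMk_nhds (π.tendsto_sobolevOp_conj_fejer X h1))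
      (Filter.Eventually.of_forall fun N => ?_)
    exact (LinearPMap.mem_graph_iff _).2 ⟨π.fejer N ζ, rfl, rfl⟩
  · have h := (hcl.isClosable).closure_mono ((π.isFormalAdjoint X).le_adjoint hd)
    have h2 : (toUnbounded (π.sobolevOp X)).adjoint.closure
        = (toUnbounded (π.sobolevOp X)).adjoint := by
      refine LinearPMap.eq_of_eq_graph ?_
      rw [← hcl.isClosable.graph_closure_eq_closure_graph]
      exact hcl.submodule_topologicalClosure_eq
    rwa [h2] at h

end PositiveEnergyRep

section Unbounded

variable {H : Type*} [NormedAddCommGroup H] [InnerProductSpace ℂ H]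

theorem adjoint_closure_eq [CompleteSpace H] {T : H →ₗ.[ℂ] H} (hd : Dense (T.domain : Set H))
    (hT : T.IsClosable) : T.closure.adjoint = T.adjoint := by
  have hd' : Dense (T.closure.domain : Set H) := hd.mono T.le_closure.1
  refine LinearPMap.eq_of_eq_graph ?_
  rw [LinearPMap.adjoint_graph_eq_graph_adjoint hd', LinearPMap.adjoint_graph_eq_graph_adjoint hd,
    ← hT.graph_closure_eq_closure_graph]
  ext ⟨x, y⟩
  rw [Submodule.mem_adjoint_iff, Submodule.mem_adjoint_iff]
  refine ⟨fun h a b hab => h a b (subset_closure hab), fun h a b hab => ?_⟩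
  have hc : IsClosed {p : H × H | ⟪p.2, x⟫_ℂ - ⟪p.1, y⟫_ℂ = 0} :=
    isClosed_eq (by fun_prop) continuous_const
  exact closure_minimal (fun p hp => h p.1 p.2 hp) hc hab

theorem isClosed_neg {T : H →ₗ.[ℂ] H} (hT : T.IsClosed) : (-T).IsClosed := by
  have h : ((-T).graph : Set (H × H)) = (fun p : H × H => (p.1, -p.2)) ⁻¹' T.graph := by
    ext ⟨x, y⟩
    simp only [Set.mem_preimage, SetLike.mem_coe, LinearPMap.mem_graph_iff]
    refine exists_congr fun z => and_congr_right fun _ => ?_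
    rw [LinearPMap.neg_apply, neg_eq_iff_eq_neg]
  rw [LinearPMap.IsClosed, h]
  exact IsClosed.preimage (by fun_prop) hT

theorem neg_le_neg_linearPMap {S T : H →ₗ.[ℂ] H} (h : S ≤ T) : -S ≤ -T :=
  ⟨h.1, fun x y hxy => by
    rw [LinearPMap.neg_apply, LinearPMap.neg_apply]
    exact congrArg _ (h.2 hxy)⟩

theorem closure_neg_le {T : H →ₗ.[ℂ] H} (hT : T.IsClosable) : (-T).closure ≤ -T.closure := by
  have hcl := isClosed_neg hT.closure_isClosed
  have h := hcl.isClosable.closure_mono (neg_le_neg_linearPMap T.le_closure)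
  have h2 : (-T.closure).closure = -T.closure := by
    refine LinearPMap.eq_of_eq_graph ?_
    rw [← hcl.isClosable.graph_closure_eq_closure_graph]
    exact hcl.submodule_topologicalClosure_eq
  rwa [h2] at h

theorem closure_neg_eq {T : H →ₗ.[ℂ] H} (hT : T.IsClosable) (hT' : (-T).IsClosable) :
    (-T).closure = -T.closure := by
  refine le_antisymm (closure_neg_le hT) ?_
  have h := neg_le_neg_linearPMap (closure_neg_le hT')
  rwa [neg_neg, neg_neg] at h

end Unbounded

namespace PositiveEnergyRep

variable {𝔤 : Type*} [NormedLieRing 𝔤] [NormedLieAlgebra 𝔤]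
    [FiniteDimensional ℂ 𝔤] [LieAlgebra.IsSimple ℂ 𝔤]
    [StarAddMonoid 𝔤] [StarModule ℂ 𝔤] [NormedStarGroup 𝔤]
    {𝔥 : LieSubalgebra ℂ 𝔤} [𝔥.IsCartanSubalgebra]
    {H : Type*} [NormedAddCommGroup H] [InnerProductSpace ℂ H] [CompleteSpace H]
    (π : PositiveEnergyRep 𝔤 𝔥 H)

theorem isEssentiallySkewAdjoint {X : sobolevLoops 𝔤 (3 / 2)}
    (hX : sobolevLoops.IsRealFormValued X) :
    IsEssentiallySkewAdjoint (toUnbounded (π.sobolevOp X)) := by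
  have hconj : sobolevLoops.conj X = -X := by
    refine Subtype.ext (Lp.ext ?_)
    filter_upwards [Lp.coeFn_star X.1, Lp.coeFn_neg X.1, hX] with θ h1 h2 h3
    exact h1.trans (h3.trans h2.symm)
  have hneg : toUnbounded (π.sobolevOp (sobolevLoops.conj X))
      = -toUnbounded (π.sobolevOp X) := by
    rw [hconj, map_neg]
    rfl
  refine ⟨π.dense_domain X, π.isClosable X, ?_⟩
  have h := π.isClosable (sobolevLoops.conj X)
  rw [adjoint_closure_eq (π.dense_domain X) (π.isClosable X), π.adjoint_eq_closure, hneg]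
  rw [hneg] at h
  exact closure_neg_eq (π.isClosable X) h

end PositiveEnergyRep

end LoopAlgebra

theorem mainTheorem12 {𝔤 : Type*} [NormedLieRing 𝔤] [NormedLieAlgebra 𝔤]
    [FiniteDimensional ℂ 𝔤] [LieAlgebra.IsSimple ℂ 𝔤]
    [StarAddMonoid 𝔤] [StarModule ℂ 𝔤] [NormedStarGroup 𝔤] [IsCompactInvolution 𝔤]
    (𝔥 : LieSubalgebra ℂ 𝔤) [𝔥.IsCartanSubalgebra]
    {H : Type*} [NormedAddCommGroup H] [InnerProductSpace ℂ H] [CompleteSpace H]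
    (π : PositiveEnergyRep 𝔤 𝔥 H) :
    ∃ ρ : sobolevLoops 𝔤 (3 / 2) →ₗ[ℂ] (π.sobolev (1 / 2) →ₗ[ℂ] H),
      -- every smooth loop lies in `H^{3/2}`, and there `ρ` extends `π`
      (∀ X : smoothLoops 𝔤, ∃ X' : sobolevLoops 𝔤 (3 / 2),
        (X'.1 =ᵐ[AddCircle.haarAddCircle] X.1) ∧
        ∀ ξ : π.smooth, ∃ h : (ξ : H) ∈ π.sobolev (1 / 2), ρ X' ⟨ξ, h⟩ = (π.op X ξ : H)) ∧
      -- `ρ` satisfies the commutation relations of `π`, as forms on `H^{1/2}`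
      (∀ X Y Z : sobolevLoops 𝔤 (3 / 2), ∀ Y' : L2Loops 𝔤,
        (Z.1 =ᵐ[AddCircle.haarAddCircle] fun θ => ⁅X.1 θ, Y.1 θ⁆) →
        IsWeakDeriv Y.1 Y' →
        ∀ ξ η : π.sobolev (1 / 2),
          ⟪ρ (sobolevLoops.conj X) ξ, ρ Y η⟫_ℂ - ⟪ρ (sobolevLoops.conj Y) ξ, ρ X η⟫_ℂ = ⟪(ξ : H), ρ Z η⟫_ℂ +
            Complex.I * π.level *
              (∫ θ, basicForm 𝔥 (X.1 θ) (Y' θ) ∂AddCircle.haarAddCircle) *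
              ⟪(ξ : H), (η : H)⟫_ℂ) ∧
      -- the energy bound
      (∃ C : ℝ, ∀ (X : sobolevLoops 𝔤 (3 / 2)) (ξ : π.sobolev (1 / 2)),
        ‖ρ X ξ‖ ≤ C * sobolevLoops.norm X * π.sobolevNorm (1 / 2) ξ) ∧
      -- closability, and `π(X)*` is the closure of `π(X*)`
      (∀ X : sobolevLoops 𝔤 (3 / 2),
        Dense ((toUnbounded (ρ X)).domain : Set H) ∧
        (toUnbounded (ρ X)).IsClosable ∧
        (toUnbounded (ρ X)).adjoint =
          (toUnbounded (ρ (sobolevLoops.conj X))).closure) ∧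
      -- essential skew-adjointness
      (∀ X : sobolevLoops 𝔤 (3 / 2), sobolevLoops.IsRealFormValued X →
        IsEssentiallySkewAdjoint (toUnbounded (ρ X))) := by
  refine ⟨π.sobolevOp, fun X => ?_, π.sobolevOp_commutator, ⟨_, π.norm_sobolevOp_le⟩,
    fun X => ⟨π.dense_domain X, π.isClosable X, π.adjoint_eq_closure X⟩,
    fun X hX => π.isEssentiallySkewAdjoint hX⟩
  obtain ⟨X', hX'⟩ := smoothLoops.exists_sobolevLoop X
  exact ⟨X', hX', fun ξ => ⟨π.smooth_le_sobolev_half ξ.2, π.sobolevOp_eq_op hX' ξ _⟩⟩
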